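/- Let $X$ be a compact metric space. A \emph{semiflow relation} on $X$ is a closed set $\Phi\subset X\times[0,\infty)\times X$ such that $(x,0,y)\in\Phi\iff y=x$, and $(x,t_1+t_2,y)\in\Phi$ iff there is $z$ with $(x,t_1,z),(z,t_2,y)\in\Phi$. For a set $C\subset X$, $\Phi_C$ is the set of $(x,t,y)$ for which there is a path $\xi:[0,t]\to C$ with $\xi(0)=x$, $\xi(t)=y$ and $(\xi(s_1),s_2-s_1,\xi(s_2))\in\Phi$ whenever $0\le s_1<s_2\le t$. Put $(\phi_C)^{[0,\varepsilon]}=\{(x,y): x=y \text{ or } (x,t,y)\in\Phi_C\text{ for some }t\in[0,\varepsilon]\}$. A \emph{hybrid dynamical system} $\mathcal H=(\Phi_C,G)$ on $X$ consists of the restriction $\Phi_C$ of a semiflow relation $\Phi$ on $X$ to a closed set $C\subset X$ and a closed relation $G\subset X\times X$. A \emph{hybrid time interval} is a set $E=\bigcup_i[t_i,t_{i+1}]\times([n_i,n_{i+1}]\cap\mathbb Z)\subset\mathbb R\times\mathbb Z$, for a finite, one-sided infinite or bi-infinite sequence $(t_i,n_i)\in\mathbb R\times\mathbb Z$ each of whose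 steps is horizontal ($t_i\le t_{i+1}$, $n_i=n_{i+1}$) or vertical ($t_i=t_{i+1}$, $n_i<n_{i+1}$). Its left (right) end-point, if there is one, is its least (greatest) element for the product order; it has infinite future (past) if $t+n$ is unbounded above (below) on it. A \emph{hybrid solution path} is a map $\xi:E\to X$ such that $(\xi(t_1,n),t_2-t_1,\xi(t_2,n))\in\Phi_C$ whenever $(t_1,n),(t_2,n)\in E$, $t_1<t_2$, and $(\xi(t,n),\xi(t,n+1))\in G$ whenever $(t,n),(t,n+1)\in E$. For $K\subset X$ let $K_-$ (resp. $K_+$) be the set of points $\xi(0,0)$ for hybrid solution paths $\xi:E\to K$ such that $(0,0)$ is the right end-point of $E$ and $E$ has infinite past (resp. $(0,0)$ is the left end-point of $E$ and $E$ has infinite future), and let $K_\pm$ be the set of points lying on some hybrid solution path $\xi:E\to K$ where $E$ has infinite past and infinite future. A set $P$ is \emph{$\mathcal H$ + invariant} if every hybrid solution path on a hybrid time interval with left and right end-points which begins in $P$ stays in $P$. For closed $K$, $\mathcal H_K=(\Phi_{C\cap K},G\cap(K\times K))$. For a relation $F$ on $X$ and $P\subset X$ put $\rho_F(P)=\overline{F(P)\setminus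 P}$ and $\partial_F(P)=P\cap\rho_F(P)$, and let $\partial_{\mathcal H}(P)=\partial_G(P)\cup\bigcap_{\varepsilon>0}\rho_{(\phi_C)^{[0,\varepsilon]}}(P)$. Write $P^\circ$, $\overline P$, $\partial P$ for interior, closure and topological boundary. A closed set $K$ is an \emph{isolating neighborhood for $A$} if $A=K_\pm\subset K^\circ$. Then an \emph{$\mathcal H$ index pair rel $K$ for $A$} is a pair $(P_1,P_2)$ of closed sets such that (i) $P_2\subset P_1\subset K$; (ii) $P_1$ and $P_2$ are $\mathcal H_K$ + invariant; (iii) $A=K_\pm\subset P_1^\circ\setminus P_2$; (iv) $P_1\setminus P_2\subset K^\circ$. Consider also the condition (iva) $\overline{P_1\setminus P_2}\subset K^\circ$. \textbf{Theorem.} Let $\mathcal H=(\Phi_C,G)$ be a hybrid dynamical system on the compact metric space $X$ and let $K$ be an isolating neighborhood for $A$. (a) If $(P_1,P_2)$ is an $\mathcal H$ index pair rel $K$ for $A$, then $K_-\subset P_1$, $K_+\cap P_2=\emptyset$ and $\partial_{\mathcal H}(P_1)\subset P_1\cap\partial K\subset P_2$. If in addition (iva) holds, then $\partial_{(\phi_C)^{[0,\varepsilon]}}(P_1)\subset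 P_2$ for some $\varepsilon>0$. (b) If $U$ and $V$ are open subsets of $X$ with $K_-\subset U$ and $K_\pm\subset V\subset K$, then there is an $\mathcal H$ index pair $(P_1,P_2)$ rel $K$ for $A$ with $P_1\subset U$ and $\overline{P_1\setminus P_2}\subset V$. In particular, (iva) holds for $(P_1,P_2)$. -/

import Mathlib

open Set

/-- A semiflow relation on `X`: a closed subset of `X × [0, ∞) × X` satisfying the initial value
condition and the Kolmogorov condition. Time is a real number, required to be nonnegative. -/
structure SemiflowRel (X : Type*) [TopologicalSpace X] where
  carrier : Set (X × ℝ × X)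
  nonneg : ∀ x t y, (x, t, y) ∈ carrier → 0 ≤ t
  isClosed : IsClosed carrier
  initial : ∀ x y, (x, 0, y) ∈ carrier ↔ y = x
  kolmogorov : ∀ x y t₁ t₂, 0 ≤ t₁ → 0 ≤ t₂ →
    ((x, t₁ + t₂, y) ∈ carrier ↔ ∃ z, (x, t₁, z) ∈ carrier ∧ (z, t₂, y) ∈ carrier)

namespace SemiflowRel

variable {X : Type*} [TopologicalSpace X]

/-- `ξ` is a (partial) solution path of `Φ` on the set of times `T`
(only the values of `ξ` on `T` matter). -/
def IsSolutionPathOn (Φ : SemiflowRel X) (T : Set ℝ) (ξ : ℝ → X) : Prop :=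
  ∀ t₁ ∈ T, ∀ t₂ ∈ T, t₁ < t₂ → (ξ t₁, t₂ - t₁, ξ t₂) ∈ Φ.carrier

/-- The restriction `Φ_C`: triples `(x, t, y)` such that some solution path of `Φ` on `[0, t]`
runs from `x` to `y` and stays in `C`. -/
def restrict (Φ : SemiflowRel X) (C : Set X) : Set (X × ℝ × X) :=
  {q | 0 ≤ q.2.1 ∧ ∃ ξ : ℝ → X, Φ.IsSolutionPathOn (Icc 0 q.2.1) ξ ∧
    (∀ s ∈ Icc 0 q.2.1, ξ s ∈ C) ∧ ξ 0 = q.1 ∧ ξ q.2.1 = q.2.2}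

/-- The relation `(φ_C)^{[a,b]}` on `X`: pairs `(x, y)` with `(x, t, y) ∈ Φ_C ∪ {(x, 0, x) : x ∈ X}`
for some `t ∈ [a, b]`. -/
def timeRel (Φ : SemiflowRel X) (C : Set X) (a b : ℝ) : SetRel X X :=
  {q | ∃ t ∈ Icc a b, (q.1, t, q.2) ∈ Φ.restrict C ∪ {r | r.2.1 = 0 ∧ r.2.2 = r.1}}

end SemiflowRel

/-- `ρ_F(K)`, the closure of `F(K) \ K`. -/
def relObstruction {X : Type*} [TopologicalSpace X] (F : SetRel X X) (K : Set X) : Set X :=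
  closure (F.image K \ K)

/-- The `F` boundary `∂_F(K) = K ∩ ρ_F(K)`. -/
def relBoundary {X : Type*} [TopologicalSpace X] (F : SetRel X X) (K : Set X) : Set X :=
  K ∩ relObstruction F K

/-- One step of the sequence generating a hybrid time interval: either horizontal (continuous
time advances, possibly by zero) or vertical (the jump counter advances). -/
def HybridStep (p q : ℝ × ℤ) : Prop :=
  (p.1 ≤ q.1 ∧ p.2 = q.2) ∨ (p.1 = q.1 ∧ p.2 < q.2)

/-- Hybrid time intervals: unions of the intervals `[pᵢ, pᵢ₊₁]` along a sequence in `ℝ × ℤ` each of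
whose steps is horizontal or vertical. A finite or one-sided sequence is made bi-infinite by
repeating its end-points (these are trivial horizontal steps), and an infinite horizontal or
vertical interval is obtained by cutting it into infinitely many finite ones. The order on `ℝ × ℤ`
is the product order, so `Icc (t₁, n₁) (t₂, n₂) = [t₁, t₂] × [n₁, n₂]`. -/
def IsHybridTimeInterval (E : Set (ℝ × ℤ)) : Prop :=
  ∃ p : ℤ → ℝ × ℤ, (∀ i, HybridStep (p i) (p (i + 1))) ∧ E = ⋃ i, Icc (p i) (p (i + 1))

/-- `E` has infinite length towards the future. -/
def HybridInfiniteForward (E : Set (ℝ × ℤ)) : Prop :=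
  ∀ M : ℝ, ∃ p ∈ E, M ≤ p.1 + (p.2 : ℝ)

/-- `E` has infinite length towards the past. -/
def HybridInfiniteBackward (E : Set (ℝ × ℤ)) : Prop :=
  ∀ M : ℝ, ∃ p ∈ E, p.1 + (p.2 : ℝ) ≤ M

/-- A hybrid dynamical system `(Φ_C, G)` on `X`: a semiflow relation `Φ` on `X`, a closed subset
`C` (to which `Φ` is restricted) and a closed relation `G` on `X`. -/
structure HybridSystem (X : Type*) [TopologicalSpace X] where
  Φ : SemiflowRel X
  C : Set X
  isClosed_C : IsClosed C
  G : SetRel X X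
  isClosed_G : IsClosed G

namespace HybridSystem

variable {X : Type*} [TopologicalSpace X]

/-- `ξ` is a hybrid solution path on the hybrid time interval `E` (only the values of `ξ` on `E`
matter): along horizontal portions it is a `Φ_C` solution path and along vertical portions it is a
`G` solution path. -/
def IsSolutionPath (H : HybridSystem X) (E : Set (ℝ × ℤ)) (ξ : ℝ × ℤ → X) : Prop :=
  IsHybridTimeInterval E ∧
  (∀ (t₁ t₂ : ℝ) (n : ℤ), (t₁, n) ∈ E → (t₂, n) ∈ E → t₁ < t₂ →
    (ξ (t₁, n), t₂ - t₁, ξ (t₂, n)) ∈ H.Φ.restrict H.C) ∧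
  (∀ (t : ℝ) (n : ℤ), (t, n) ∈ E → (t, n + 1) ∈ E → (ξ (t, n), ξ (t, n + 1)) ∈ H.G)

/-- The restriction `H_K = (Φ_{C ∩ K}, G ∩ (K × K))` of `H` to a closed set `K`. -/
def restrict (H : HybridSystem X) (K : Set X) (hK : IsClosed K) : HybridSystem X where
  Φ := H.Φ
  C := H.C ∩ K
  isClosed_C := H.isClosed_C.inter hK
  G := H.G ∩ K ×ˢ K
  isClosed_G := H.isClosed_G.inter (hK.prod hK)

/-- `A` is + invariant: every hybrid solution path on a compact hybrid time interval that begins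
in `A` remains in `A`. -/
def PlusInvariant (H : HybridSystem X) (A : Set X) : Prop :=
  ∀ (E : Set (ℝ × ℤ)) (ξ : ℝ × ℤ → X) (p q : ℝ × ℤ), H.IsSolutionPath E ξ →
    IsLeast E p → IsGreatest E q → ξ p ∈ A → ∀ r ∈ E, ξ r ∈ A

/-- `K_-`: end-points of solution paths in `K` with an infinite past. -/
def minusPart (H : HybridSystem X) (K : Set X) : Set X :=
  {x | ∃ (E : Set (ℝ × ℤ)) (ξ : ℝ × ℤ → X), H.IsSolutionPath E ξ ∧ IsGreatest E (0, 0) ∧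
    HybridInfiniteBackward E ∧ (∀ r ∈ E, ξ r ∈ K) ∧ ξ (0, 0) = x}

/-- `K_+`: starting points of solution paths in `K` with an infinite future. -/
def plusPart (H : HybridSystem X) (K : Set X) : Set X :=
  {x | ∃ (E : Set (ℝ × ℤ)) (ξ : ℝ × ℤ → X), H.IsSolutionPath E ξ ∧ IsLeast E (0, 0) ∧
    HybridInfiniteForward E ∧ (∀ r ∈ E, ξ r ∈ K) ∧ ξ (0, 0) = x}

/-- `K_±`: points on bi-infinite solution paths contained in `K`. -/
def viablePart (H : HybridSystem X) (K : Set X) : Set X :=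
  {x | ∃ (E : Set (ℝ × ℤ)) (ξ : ℝ × ℤ → X), H.IsSolutionPath E ξ ∧
    HybridInfiniteBackward E ∧ HybridInfiniteForward E ∧ (∀ r ∈ E, ξ r ∈ K) ∧
    ∃ r ∈ E, ξ r = x}

/-- The boundary `∂_H(K) = ∂_G(K) ∪ ∂_{Φ_C}(K)`, where
`∂_{Φ_C}(K) = ⋂_{ε > 0} ρ_{(φ_C)^{[0,ε]}}(K)`. -/
def boundary (H : HybridSystem X) (K : Set X) : Set X :=
  relBoundary H.G K ∪ ⋂ ε : {ε : ℝ // 0 < ε}, relObstruction (H.Φ.timeRel H.C 0 ε) K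

/-- The closed set `K` is an isolating neighborhood for the viable set `A`. -/
structure IsIsolatingNeighborhood (H : HybridSystem X) (K A : Set X) : Prop where
  isClosed : IsClosed K
  viablePart_subset : H.viablePart K ⊆ interior K
  eq_viablePart : A = H.viablePart K

/-- `(P₁, P₂)` is an `H` index pair rel the closed set `K` for `A`. -/
structure IsIndexPair (H : HybridSystem X) (K : Set X) (hK : IsClosed K) (A P₁ P₂ : Set X) :
    Prop where
  isClosed_fst : IsClosed P₁
  isClosed_snd : IsClosed P₂
  snd_subset_fst : P₂ ⊆ P₁
  fst_subset : P₁ ⊆ K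
  plusInvariant_fst : (H.restrict K hK).PlusInvariant P₁
  plusInvariant_snd : (H.restrict K hK).PlusInvariant P₂
  eq_viablePart : A = H.viablePart K
  subset_interior_diff : A ⊆ interior P₁ \ P₂
  diff_subset_interior : P₁ \ P₂ ⊆ interior K

end HybridSystem

/-! Inside `K` the hybrid system is a closed flow relation with durations together with a closed
jump relation. Give a finite path the length elapsed time plus number of jumps. Bounded length
bounds the number of jumps, so the relation "a path of length `L` leads from `x` to `y`" is closed
(`isClosed_paths`). By compactness `K_-` and `K_+` are the sets of ends and of starts of arbitrarily
long finite paths, and `K_±` is their intersection (`minusPart_eq`, `plusPart_eq`, `viablePart_eq`).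
For (b), limits of points reached from a closed set `B` are themselves reached from `B`, unless they
lie in `K_-` and `B` meets `K_+` (`of_mem_closure_reach`). Hence the reach of a closed neighborhood
of `K_-` in `K` is closed and invariant, and it shrinks to `K_-` with the neighborhood; this gives
`P₁`. If `O` is an open neighborhood of `K_+`, the reach of `P₁ \ O` is closed as well and misses
`K_+`; this gives `P₂` (`exists_index_pair`). For (a), a backward orbit in `K_-` starting off `P₁`
would accumulate in `K_±` off `interior P₁`, and a forward orbit in `K_+` starting in `P₂` would
accumulate in `K_± ∩ P₂`; both are impossible. A jump or short flow leaving an invariant set must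
leave `K`, which puts the boundary of `P₁` on the frontier of `K`. -/

/-- A closed "flow" with real durations and a closed "jump" relation on a closed set `dom`. -/
structure FlowJump (X : Type*) [TopologicalSpace X] where
  dom : Set X
  flow : Set (X × ℝ × X)
  jump : Set (X × X)
  isClosed_dom : IsClosed dom
  isClosed_flow : IsClosed flow
  isClosed_jump : IsClosed jump
  flow_nonneg : ∀ {x t y}, (x, t, y) ∈ flow → 0 ≤ t
  flow_mem : ∀ {x t y}, (x, t, y) ∈ flow → x ∈ dom ∧ y ∈ dom
  flow_refl : ∀ {x}, x ∈ dom → (x, 0, x) ∈ flow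
  flow_zero : ∀ {x y}, (x, 0, y) ∈ flow → x = y
  flow_add : ∀ {x y z s t}, (x, s, y) ∈ flow → (y, t, z) ∈ flow → (x, s + t, z) ∈ flow
  flow_split : ∀ {x y s t}, 0 ≤ s → 0 ≤ t → (x, s + t, y) ∈ flow →
    ∃ z, (x, s, z) ∈ flow ∧ (z, t, y) ∈ flow
  jump_mem : ∀ {x y}, (x, y) ∈ jump → x ∈ dom ∧ y ∈ dom

/-! ### Finite paths, their lengths, and invariant sets. -/

namespace FlowJump

section Topological

variable {X : Type*} [TopologicalSpace X] (D : FlowJump X)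

/-- Time reversal. -/
def reverse : FlowJump X where
  dom := D.dom
  flow := {q | (q.2.2, q.2.1, q.1) ∈ D.flow}
  jump := {q | (q.2, q.1) ∈ D.jump}
  isClosed_dom := D.isClosed_dom
  isClosed_flow := D.isClosed_flow.preimage (by fun_prop)
  isClosed_jump := D.isClosed_jump.preimage (by fun_prop)
  flow_nonneg h := D.flow_nonneg h
  flow_mem h := (D.flow_mem h).symm
  flow_refl h := D.flow_refl h
  flow_zero h := (D.flow_zero h).symm
  flow_add {x y z s t} h₁ h₂ := by
    have := D.flow_add h₂ h₁
    rwa [add_comm] at this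
  flow_split {x y s t} hs ht h := by
    have h' : (y, t + s, x) ∈ D.flow := by rw [add_comm]; exact h
    obtain ⟨z, h₁, h₂⟩ := D.flow_split ht hs h'
    exact ⟨z, h₂, h₁⟩
  jump_mem h := (D.jump_mem h).symm

lemma mem_reverse_flow {x y : X} {t : ℝ} : (x, t, y) ∈ D.reverse.flow ↔ (y, t, x) ∈ D.flow :=
  Iff.rfl

/-- Triples `(x, L, y)` such that a finite path with `n` jumps and total length `L` (elapsed time
plus number of jumps) leads from `x` to `y`. -/
def pathsN : ℕ → Set (X × ℝ × X)
  | 0 => D.flow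
  | n + 1 => {q | ∃ s u v, (q.1, s, u) ∈ pathsN n ∧ (u, v) ∈ D.jump ∧
      (v, q.2.1 - s - 1, q.2.2) ∈ D.flow}

/-- Triples `(x, L, y)` such that a finite path of length `L` leads from `x` to `y`. -/
def paths : Set (X × ℝ × X) := ⋃ n, D.pathsN n

variable {D}

lemma flow_subset_paths : D.flow ⊆ D.paths := subset_iUnion D.pathsN 0

/-- Each jump contributes 1 to the length. This is what makes `paths` a locally finite union. -/
lemma natCast_le_of_mem_pathsN {n : ℕ} {x y : X} {L : ℝ} (h : (x, L, y) ∈ D.pathsN n) :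
    (n : ℝ) ≤ L := by
  induction n generalizing L y with
  | zero => simpa using D.flow_nonneg h
  | succ n ih =>
    obtain ⟨s, u, v, h₁, -, h₃⟩ := h
    have := ih h₁
    have := D.flow_nonneg h₃
    push_cast
    simp only at this
    linarith

lemma paths_nonneg {x y : X} {L : ℝ} (h : (x, L, y) ∈ D.paths) : 0 ≤ L := by
  obtain ⟨n, h⟩ := mem_iUnion.1 h
  exact n.cast_nonneg.trans (natCast_le_of_mem_pathsN h)

lemma paths_add_flow {x y z : X} {s t : ℝ} (h₁ : (x, s, y) ∈ D.paths) (h₂ : (y, t, z) ∈ D.flow) :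
    (x, s + t, z) ∈ D.paths := by
  obtain ⟨n, h⟩ := mem_iUnion.1 h₁
  refine mem_iUnion.2 ⟨n, ?_⟩
  cases n with
  | zero => exact D.flow_add h h₂
  | succ n =>
    obtain ⟨r, u, v, h₃, h₄, h₅⟩ := h
    refine ⟨r, u, v, h₃, h₄, ?_⟩
    convert D.flow_add h₅ h₂ using 3
    simp only
    ring

lemma paths_mem {x y : X} {L : ℝ} (h : (x, L, y) ∈ D.paths) : x ∈ D.dom ∧ y ∈ D.dom := by
  obtain ⟨n, h'⟩ := mem_iUnion.1 h
  clear h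
  induction n generalizing L y with
  | zero => exact D.flow_mem h'
  | succ n ih =>
    obtain ⟨s, u, v, h₁, -, h₃⟩ := h'
    exact ⟨(ih h₁).1, (D.flow_mem h₃).2⟩

lemma paths_add_jump {x y z : X} {s : ℝ} (h₁ : (x, s, y) ∈ D.paths) (h₂ : (y, z) ∈ D.jump) :
    (x, s + 1, z) ∈ D.paths := by
  obtain ⟨n, h⟩ := mem_iUnion.1 h₁
  refine mem_iUnion.2 ⟨n + 1, s, y, z, h, h₂, ?_⟩
  simpa using D.flow_refl (D.jump_mem h₂).2

lemma jump_mem_paths {x y : X} (h : (x, y) ∈ D.jump) : (x, 1, y) ∈ D.paths := by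
  simpa using paths_add_jump (flow_subset_paths (D.flow_refl (D.jump_mem h).1)) h

/-- Induction along a path, lengthening it at its end. -/
@[elab_as_elim]
lemma paths_induction {x : X} {p : ∀ L y, (x, L, y) ∈ D.paths → Prop}
    (flow : ∀ t y (h : (x, t, y) ∈ D.flow), p t y (flow_subset_paths h))
    (step : ∀ s u v t y (h : (x, s, u) ∈ D.paths) (hj : (u, v) ∈ D.jump) (hf : (v, t, y) ∈ D.flow),
      p s u h → p (s + 1 + t) y (paths_add_flow (paths_add_jump h hj) hf))
    {L : ℝ} {y : X} (h : (x, L, y) ∈ D.paths) : p L y h := by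
  have key : ∀ n L y (h : (x, L, y) ∈ D.pathsN n), p L y (mem_iUnion.2 ⟨n, h⟩) := by
    intro n
    induction n with
    | zero => exact flow
    | succ n ih =>
      rintro L y ⟨s, u, v, h₁, h₂, h₃⟩
      have := step s u v _ y (mem_iUnion.2 ⟨n, h₁⟩) h₂ h₃ (ih s u h₁)
      have hL : s + 1 + (L - s - 1) = L := by ring
      simpa only [hL] using this
  obtain ⟨n, h⟩ := mem_iUnion.1 h
  exact key n L y h

lemma paths_add {x y z : X} {s t : ℝ} (h₁ : (x, s, y) ∈ D.paths) (h₂ : (y, t, z) ∈ D.paths) :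
    (x, s + t, z) ∈ D.paths := by
  induction h₂ using paths_induction with
  | flow t z h => exact paths_add_flow h₁ h
  | step r u v t z _ hj hf ih =>
    have := paths_add_flow (paths_add_jump ih hj) hf
    convert this using 3
    ring

lemma mem_reverse_paths_of_mem {x y : X} {L : ℝ} (h : (x, L, y) ∈ D.paths) :
    (y, L, x) ∈ D.reverse.paths := by
  induction h using paths_induction with
  | flow t z h => exact flow_subset_paths h
  | step r u v t z _ hj hf ih =>
    have h₁ : (z, t, v) ∈ D.reverse.paths := flow_subset_paths hf
    have h₂ : (v, u) ∈ D.reverse.jump := hj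
    convert paths_add (paths_add_jump h₁ h₂) ih using 3
    ring

lemma mem_reverse_paths {x y : X} {L : ℝ} : (x, L, y) ∈ D.reverse.paths ↔ (y, L, x) ∈ D.paths :=
  ⟨fun h ↦ mem_reverse_paths_of_mem h, mem_reverse_paths_of_mem⟩

/-- A path of length at least `1` starts with a flow of duration at most `1`, followed by a jump or
a flow of duration `1`. -/
lemma exists_head {x y : X} {L : ℝ} (h : (x, L, y) ∈ D.paths) (hL : 1 ≤ L) :
    ∃ t u z, 0 ≤ t ∧ t ≤ 1 ∧ (x, t, u) ∈ D.flow ∧ ((u, z) ∈ D.jump ∨ (u, 1, z) ∈ D.flow) ∧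
      (z, L - 1 - t, y) ∈ D.paths := by
  have hx := (paths_mem h).1
  have key : (x, L, y) ∈ D.flow ∨ ∃ t u z, (x, t, u) ∈ D.flow ∧ (u, z) ∈ D.jump ∧
      (z, L - 1 - t, y) ∈ D.paths := by
    clear hL
    induction h using paths_induction with
    | flow t z h => exact Or.inl h
    | step r u v t z _ hj hf ih =>
      right
      rcases ih with ih | ⟨t', u', z', h₁, h₂, h₃⟩
      · refine ⟨r, u, v, ih, hj, flow_subset_paths ?_⟩
        convert hf using 3
        ring
      · refine ⟨t', u', z', h₁, h₂, ?_⟩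
        convert paths_add_flow (paths_add_jump h₃ hj) hf using 3
        ring
  rcases key with h | ⟨t, u, z, h₁, h₂, h₃⟩
  · obtain ⟨z, h₁, h₂⟩ := D.flow_split (s := 1) (t := L - 1) zero_le_one (by linarith)
      (by simpa using h)
    exact ⟨0, x, z, le_rfl, zero_le_one, D.flow_refl hx, Or.inr h₁,
      by simpa using flow_subset_paths h₂⟩
  -- A first flow longer than 1 is cut at time 1 and the initial flow is taken to be trivial, so
  -- that `t` always stays in a compact interval.
  · by_cases ht : t ≤ 1
    · exact ⟨t, u, z, D.flow_nonneg h₁, ht, h₁, Or.inl h₂, h₃⟩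
    · obtain ⟨w, h₄, h₅⟩ := D.flow_split (s := 1) (t := t - 1) zero_le_one (by linarith)
        (by simpa using h₁)
      refine ⟨0, x, w, le_rfl, zero_le_one, D.flow_refl hx, Or.inr h₄, ?_⟩
      convert paths_add (paths_add_jump (flow_subset_paths h₅) h₂) h₃ using 3
      ring

/-- A flow can be cut at length exactly `M`, but a jump can pass over `M`; hence the overshoot of at
most 1. -/
lemma exists_prefix {x y : X} {L M : ℝ} (h : (x, L, y) ∈ D.paths) (hM : 0 ≤ M) (hL : M ≤ L) :
    ∃ L' z, M ≤ L' ∧ L' ≤ M + 1 ∧ (x, L', z) ∈ D.paths := by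
  induction h using paths_induction with
  | flow t y h =>
    obtain ⟨z, h₁, -⟩ := D.flow_split hM (sub_nonneg.2 hL) (by simpa using h)
    exact ⟨M, z, le_rfl, by linarith, flow_subset_paths h₁⟩
  | step s u v t y hp hj hf ih =>
    rcases le_total M s with h | h
    · exact ih h
    rcases le_total M (s + 1) with h' | h'
    · exact ⟨s + 1, v, h', by linarith, paths_add_jump hp hj⟩
    · obtain ⟨z, h₁, -⟩ := D.flow_split (s := M - (s + 1)) (t := t - (M - (s + 1)))
        (by linarith) (by linarith) (by simpa using hf)
      refine ⟨M, z, le_rfl, by linarith, ?_⟩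
      simpa using paths_add_flow (paths_add_jump hp hj) h₁

variable (D) in
/-- Starting points of paths of length at least `M`. -/
def longFrom (M : ℝ) : Set X := {x | ∃ L y, M ≤ L ∧ (x, L, y) ∈ D.paths}

lemma longFrom_anti {M N : ℝ} (h : M ≤ N) : D.longFrom N ⊆ D.longFrom M :=
  fun _ ⟨L, y, hL, hp⟩ ↦ ⟨L, y, h.trans hL, hp⟩

variable (D) in
/-- Starting points of arbitrarily long paths. -/
def plus : Set X := ⋂ n : ℕ, D.longFrom n

variable (D) in
/-- End-points of arbitrarily long paths. -/
def minus : Set X := D.reverse.plus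

lemma mem_plus_iff {x : X} : x ∈ D.plus ↔ ∀ M : ℝ, ∃ L y, M ≤ L ∧ (x, L, y) ∈ D.paths := by
  refine ⟨fun h M ↦ ?_, fun h ↦ mem_iInter.2 fun n ↦ h n⟩
  obtain ⟨n, hn⟩ := exists_nat_ge M
  exact longFrom_anti hn (mem_iInter.1 h n)

lemma mem_minus_iff {y : X} : y ∈ D.minus ↔ ∀ M : ℝ, ∃ L x, M ≤ L ∧ (x, L, y) ∈ D.paths := by
  simp only [minus, mem_plus_iff, mem_reverse_paths]

lemma plus_subset_dom : D.plus ⊆ D.dom := fun _ h ↦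
  let ⟨_, _, _, h⟩ := mem_plus_iff.1 h 0
  (paths_mem h).1

lemma minus_subset_dom : D.minus ⊆ D.dom := D.reverse.plus_subset_dom

lemma mem_plus_of_paths {x y : X} {L : ℝ} (h : (x, L, y) ∈ D.paths) (hy : y ∈ D.plus) :
    x ∈ D.plus := by
  rw [mem_plus_iff] at hy ⊢
  intro M
  obtain ⟨L', z, h₁, h₂⟩ := hy M
  exact ⟨L + L', z, by linarith [paths_nonneg h], paths_add h h₂⟩

lemma mem_minus_of_paths {x y : X} {L : ℝ} (h : (x, L, y) ∈ D.paths) (hx : x ∈ D.minus) :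
    y ∈ D.minus := mem_plus_of_paths (D := D.reverse) (mem_reverse_paths_of_mem h) hx

variable (D) in
/-- `B` together with everything that can be reached from it. -/
def reach (B : Set X) : Set X := {y | ∃ x ∈ B, ∃ L, (x, L, y) ∈ D.paths}

lemma reach_mono {B B' : Set X} (h : B ⊆ B') : D.reach B ⊆ D.reach B' :=
  fun _ ⟨x, hx, hL⟩ ↦ ⟨x, h hx, hL⟩

lemma subset_reach {B : Set X} (h : B ⊆ D.dom) : B ⊆ D.reach B :=
  fun x hx ↦ ⟨x, hx, 0, flow_subset_paths (D.flow_refl (h hx))⟩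

variable (D) in
/-- No finite path leaves `P`. -/
def Invariant (P : Set X) : Prop := ∀ x ∈ P, ∀ L y, (x, L, y) ∈ D.paths → y ∈ P

lemma invariant_reach (B : Set X) : D.Invariant (D.reach B) := by
  rintro x ⟨w, hw, L, h⟩ L' y h'
  exact ⟨w, hw, _, paths_add h h'⟩

lemma Invariant.reach_subset {B P : Set X} (hP : D.Invariant P) (h : B ⊆ P) : D.reach B ⊆ P := by
  rintro y ⟨x, hx, L, hL⟩
  exact hP x (h hx) L y hL

lemma invariant_of_flow_of_jump {P : Set X} (h₁ : ∀ x ∈ P, ∀ t y, (x, t, y) ∈ D.flow → y ∈ P)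
    (h₂ : ∀ x ∈ P, ∀ y, (x, y) ∈ D.jump → y ∈ P) : D.Invariant P := by
  intro x hx L y h
  induction h using paths_induction with
  | flow t y h => exact h₁ x hx t y h
  | step s u v t y _ hj hf ih => exact h₁ v (h₂ u ih v hj) t y hf

end Topological

/-! ### Chains of single flows and jumps labelled by hybrid times. -/

section Elementary

variable {X : Type*} [TopologicalSpace X] {D : FlowJump X}

variable (D) in
/-- A single flow or jump, between points labelled with hybrid times. -/
def Elementary (a b : X × (ℝ × ℤ)) : Prop :=
  (a.2.2 = b.2.2 ∧ (a.1, b.2.1 - a.2.1, b.1) ∈ D.flow) ∨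
    (a.2.1 = b.2.1 ∧ b.2.2 = a.2.2 + 1 ∧ (a.1, b.1) ∈ D.jump)

lemma Elementary.refl {a : X × (ℝ × ℤ)} (h : a.1 ∈ D.dom) : D.Elementary a a :=
  Or.inl ⟨rfl, by simpa using D.flow_refl h⟩

lemma Elementary.hybridStep {a b : X × (ℝ × ℤ)} (h : D.Elementary a b) : HybridStep a.2 b.2 := by
  rcases h with ⟨h₁, h₂⟩ | ⟨h₁, h₂, -⟩
  · exact Or.inl ⟨sub_nonneg.1 (D.flow_nonneg h₂), h₁⟩
  · exact Or.inr ⟨h₁, by omega⟩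

lemma Elementary.eq_of_eq {a b : X × (ℝ × ℤ)} (h : D.Elementary a b) (hab : a.2 = b.2) :
    a.1 = b.1 := by
  rcases h with ⟨-, h₂⟩ | ⟨-, h₂, -⟩
  · rw [hab, sub_self] at h₂
    exact D.flow_zero h₂
  · rw [hab] at h₂
    omega

lemma Elementary.of_reverse {a b : X × (ℝ × ℤ)} (h : D.reverse.Elementary a b) :
    D.Elementary (b.1, -b.2) (a.1, -a.2) := by
  rcases h with ⟨h₁, h₂⟩ | ⟨h₁, h₂, h₃⟩
  · refine Or.inl ⟨by simp [h₁], ?_⟩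
    convert mem_reverse_flow D |>.1 h₂ using 3
    simp
    ring
  · exact Or.inr ⟨by simp [h₁], by simp [h₂], h₃⟩

/-- Two one-sided chains with a common starting state combine to a bi-infinite one. -/
lemma exists_int_chain {α : Type*} {R : α → α → Prop} {f g : ℕ → α} (h₀ : f 0 = g 0)
    (hf : ∀ n, R (f n) (f (n + 1))) (hg : ∀ n, R (g (n + 1)) (g n)) :
    ∃ c : ℤ → α, (∀ i, R (c i) (c (i + 1))) ∧ (∀ n : ℕ, c n = f n) ∧ ∀ n : ℕ, c (-n) = g n := by
  refine ⟨fun i ↦ if 0 ≤ i then f i.toNat else g (-i).toNat, fun i ↦ ?_, fun n ↦ by simp,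
    fun n ↦ ?_⟩
  · rcases lt_trichotomy i (-1) with hi | rfl | hi
    · have : (-i).toNat = (-(i + 1)).toNat + 1 := by omega
      simp only [show ¬ 0 ≤ i by omega, show ¬ 0 ≤ i + 1 by omega, if_false, this]
      exact hg _
    · simpa [h₀] using hg 0
    · have : (i + 1).toNat = i.toNat + 1 := by omega
      simp only [show 0 ≤ i by omega, show 0 ≤ i + 1 by omega, if_true, this]
      exact hf _
  · rcases n with _ | n
    · simp [h₀]
    · simp
      intro h
      omega

end Elementary

/-! ### Compactness: closedness of path relations and long-path limits. -/

section Compact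

variable {X : Type*} [TopologicalSpace X] [CompactSpace X] {D : FlowJump X}

/-- The data of the last jump stay in a compact set: its endpoints in `X`, and the length before it
in a bounded interval. They therefore converge along an ultrafilter. -/
lemma isClosed_pathsN (n : ℕ) : IsClosed (D.pathsN n) := by
  induction n with
  | zero => exact D.isClosed_flow
  | succ n ih =>
    rw [isClosed_iff_ultrafilter]
    rintro ⟨x, L, y⟩ F hF hmem
    have hx : Filter.Tendsto (fun q : X × ℝ × X ↦ q.1) F (nhds x) :=
      (continuous_fst.tendsto _).mono_left hF
    have hL : Filter.Tendsto (fun q : X × ℝ × X ↦ q.2.1) F (nhds L) :=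
      ((by fun_prop : Continuous fun q : X × ℝ × X ↦ q.2.1).tendsto (x, L, y)).mono_left hF
    have hy : Filter.Tendsto (fun q : X × ℝ × X ↦ q.2.2) F (nhds y) :=
      ((by fun_prop : Continuous fun q : X × ℝ × X ↦ q.2.2).tendsto (x, L, y)).mono_left hF
    have hX : Nonempty X := ⟨x⟩
    have : ∀ q : X × ℝ × X, ∃ s u v, q ∈ D.pathsN (n + 1) → (q.1, s, u) ∈ D.pathsN n ∧
        (u, v) ∈ D.jump ∧ (v, q.2.1 - s - 1, q.2.2) ∈ D.flow := by
      intro q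
      by_cases hq : q ∈ D.pathsN (n + 1)
      · obtain ⟨s, u, v, h⟩ := hq
        exact ⟨s, u, v, fun _ ↦ h⟩
      · exact ⟨0, x, x, fun h ↦ absurd h hq⟩
    choose s u v h using this
    have hs : ∀ᶠ q in (F : Filter (X × ℝ × X)), s q ∈ Icc 0 (L + 1) := by
      filter_upwards [hmem, hL.eventually_le_const (lt_add_one L)] with q hq hq'
      have h₁ := paths_nonneg (mem_iUnion.2 ⟨n, (h q hq).1⟩)
      have h₂ := D.flow_nonneg (h q hq).2.2
      exact ⟨h₁, by linarith⟩
    obtain ⟨s₀, -, hs₀⟩ := isCompact_iff_ultrafilter_le_nhds.1 (isCompact_Icc (a := (0 : ℝ))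
      (b := L + 1)) (F.map s) (Filter.le_principal_iff.2 hs)
    obtain ⟨u₀, -, hu₀⟩ := isCompact_iff_ultrafilter_le_nhds.1 (isCompact_univ (X := X))
      (F.map u) (by simp)
    obtain ⟨v₀, -, hv₀⟩ := isCompact_iff_ultrafilter_le_nhds.1 (isCompact_univ (X := X))
      (F.map v) (by simp)
    have hs₀ : Filter.Tendsto s F (nhds s₀) := hs₀
    have hu₀ : Filter.Tendsto u F (nhds u₀) := hu₀
    have hv₀ : Filter.Tendsto v F (nhds v₀) := hv₀
    refine ⟨s₀, u₀, v₀, ?_, ?_, ?_⟩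
    · exact ih.mem_of_tendsto (hx.prodMk_nhds (hs₀.prodMk_nhds hu₀))
        (Filter.mem_of_superset hmem fun q hq ↦ (h q hq).1)
    · exact D.isClosed_jump.mem_of_tendsto (hu₀.prodMk_nhds hv₀)
        (Filter.mem_of_superset hmem fun q hq ↦ (h q hq).2.1)
    · exact D.isClosed_flow.mem_of_tendsto
        (hv₀.prodMk_nhds (((hL.sub hs₀).sub_const 1).prodMk_nhds hy))
        (Filter.mem_of_superset hmem fun q hq ↦ (h q hq).2.2)

lemma isClosed_paths : IsClosed D.paths := by
  refine LocallyFinite.isClosed_iUnion (fun q ↦ ?_) isClosed_pathsN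
  obtain ⟨N, hN⟩ := exists_nat_gt (q.2.1 + 1)
  refine ⟨{r | r.2.1 < q.2.1 + 1}, (isOpen_lt (by fun_prop) continuous_const).mem_nhds
    (by simp), (finite_lt_nat N).subset ?_⟩
  rintro n ⟨⟨x, L, y⟩, h₁, h₂⟩
  have := natCast_le_of_mem_pathsN h₁
  have h₂ : L < q.2.1 + 1 := h₂
  have : (n : ℝ) < N := by linarith
  exact_mod_cast this

/-- Points reached from a closed set by paths of bounded length form a closed set. -/
lemma isClosed_reach_Icc {B : Set X} (hB : IsClosed B) (a b : ℝ) :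
    IsClosed {y | ∃ x ∈ B, ∃ L ∈ Icc a b, (x, L, y) ∈ D.paths} := by
  have hc : IsCompact (B ×ˢ Icc a b) := hB.isCompact.prod isCompact_Icc
  have : {y | ∃ x ∈ B, ∃ L ∈ Icc a b, (x, L, y) ∈ D.paths} =
      Prod.snd '' {q : (B ×ˢ Icc a b : Set (X × ℝ)) × X |
        ((q.1 : X × ℝ).1, (q.1 : X × ℝ).2, q.2) ∈ D.paths} := by
    ext y
    constructor
    · rintro ⟨x, hx, L, hL, h⟩
      exact ⟨(⟨(x, L), hx, hL⟩, y), h, rfl⟩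
    · rintro ⟨⟨⟨⟨x, L⟩, hx, hL⟩, z⟩, h, rfl⟩
      exact ⟨x, hx, L, hL, h⟩
  rw [this]
  have := isCompact_iff_compactSpace.1 hc
  exact isClosedMap_snd_of_compactSpace _ (isClosed_paths.preimage (by fun_prop))

/-- Long paths may be truncated to length in `[M, M + 1]` by `exists_prefix`, which reduces the
claim to bounded lengths in reversed time. -/
lemma isClosed_longFrom {M : ℝ} (hM : 0 ≤ M) : IsClosed (D.longFrom M) := by
  convert isClosed_reach_Icc (D := D.reverse) isClosed_univ M (M + 1)
  ext x
  constructor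
  · rintro ⟨L, y, hL, h⟩
    obtain ⟨L', z, h₁, h₂, h₃⟩ := exists_prefix h hM hL
    exact ⟨z, mem_univ _, L', ⟨h₁, h₂⟩, mem_reverse_paths_of_mem h₃⟩
  · rintro ⟨z, -, L', ⟨h₁, h₂⟩, h₃⟩
    exact ⟨L', z, h₁, mem_reverse_paths.1 h₃⟩

lemma isClosed_plus : IsClosed D.plus := isClosed_iInter fun n ↦ isClosed_longFrom n.cast_nonneg

lemma isClosed_minus : IsClosed D.minus := isClosed_plus

/-- A point from which arbitrarily long paths start has a successor of the same kind. -/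
lemma exists_step_of_mem_plus {x : X} (hx : x ∈ D.plus) :
    ∃ t u z, (x, t, u) ∈ D.flow ∧ ((u, z) ∈ D.jump ∨ (u, 1, z) ∈ D.flow) ∧ z ∈ D.plus := by
  -- `S n` collects the first moves from `x` after which a path of length at least `n` remains; a
  -- common element is the required step.
  let S : ℕ → Set (ℝ × X × X) := fun n ↦ {q | q.1 ∈ Icc 0 1 ∧ (x, q.1, q.2.1) ∈ D.flow ∧
    ((q.2.1, q.2.2) ∈ D.jump ∨ (q.2.1, 1, q.2.2) ∈ D.flow) ∧ q.2.2 ∈ D.longFrom n}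
  have hS : ∀ n, IsClosed (S n) := fun n ↦
    (isClosed_Icc.preimage continuous_fst).inter ((D.isClosed_flow.preimage (by fun_prop)).inter
      (((D.isClosed_jump.preimage (by fun_prop)).union
        (D.isClosed_flow.preimage (by fun_prop))).inter
        ((isClosed_longFrom n.cast_nonneg).preimage (by fun_prop))))
  obtain ⟨⟨t, u, z⟩, h⟩ := IsCompact.nonempty_iInter_of_sequence_nonempty_isCompact_isClosed S
    (fun n q hq ↦ ⟨hq.1, hq.2.1, hq.2.2.1, longFrom_anti (by simp) hq.2.2.2⟩)
    (fun n ↦ by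
      -- The first move uses up length at most 2.
      obtain ⟨L, y, hL, h⟩ := mem_plus_iff.1 hx (n + 2)
      obtain ⟨t, u, z, h₀, h₁, h₂, h₃, h₄⟩ := exists_head h
        (by linarith [(n.cast_nonneg : (0 : ℝ) ≤ n)])
      exact ⟨(t, u, z), ⟨h₀, h₁⟩, h₂, h₃, _, y, by linarith, h₄⟩)
    ((isCompact_Icc (a := (0 : ℝ)) (b := 1)).prod isCompact_univ |>.of_isClosed_subset (hS 0)
      fun q hq ↦ ⟨hq.1, mem_univ _⟩) hS
  rw [mem_iInter] at h
  exact ⟨t, u, z, (h 0).2.1, (h 0).2.2.1, mem_iInter.2 fun n ↦ (h n).2.2.2⟩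

lemma nonempty_inter_plus {B : Set X} (hB : IsClosed B)
    (h : ∀ n : ℕ, (B ∩ D.longFrom n).Nonempty) : (B ∩ D.plus).Nonempty := by
  have hS : ∀ n : ℕ, IsClosed (B ∩ D.longFrom n) :=
    fun n ↦ hB.inter (isClosed_longFrom n.cast_nonneg)
  obtain ⟨x, hx⟩ := IsCompact.nonempty_iInter_of_sequence_nonempty_isCompact_isClosed
    (fun n : ℕ ↦ B ∩ D.longFrom n)
    (fun n ↦ inter_subset_inter_right _ (longFrom_anti (by simp))) h (hS 0).isCompact hS
  rw [mem_iInter] at hx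
  exact ⟨x, (hx 0).1, mem_iInter.2 fun n ↦ (hx n).2⟩

/-- Limits of points reached from a closed set `B` are reached from `B`, unless they are limits of
end-points of arbitrarily long paths. -/
lemma of_mem_closure_reach {B : Set X} (hB : IsClosed B) {y : X} (hy : y ∈ closure (D.reach B))
    (hy' : y ∉ D.reach B) : y ∈ D.minus ∧ (B ∩ D.plus).Nonempty := by
  have key : ∀ n : ℕ, y ∈ closure {y | ∃ x ∈ B, ∃ L, (n : ℝ) ≤ L ∧ (x, L, y) ∈ D.paths} := by
    intro n
    -- Lengths at most `n` give a closed set not containing `y`, so `y` is a limit of ends of paths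
    -- of length at least `n`.
    have hsub : D.reach B ⊆ {y | ∃ x ∈ B, ∃ L ∈ Icc (0 : ℝ) n, (x, L, y) ∈ D.paths} ∪
        {y | ∃ x ∈ B, ∃ L, (n : ℝ) ≤ L ∧ (x, L, y) ∈ D.paths} := by
      rintro z ⟨x, hx, L, h⟩
      rcases le_total L n with hn | hn
      · exact Or.inl ⟨x, hx, L, ⟨paths_nonneg h, hn⟩, h⟩
      · exact Or.inr ⟨x, hx, L, hn, h⟩
    have := closure_mono hsub hy
    rw [closure_union, (isClosed_reach_Icc hB 0 n).closure_eq] at this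
    refine this.resolve_left ?_
    rintro ⟨x, hx, L, -, h⟩
    exact hy' ⟨x, hx, L, h⟩
  constructor
  · refine mem_iInter.2 fun n ↦ closure_minimal ?_ (isClosed_longFrom n.cast_nonneg) (key n)
    rintro z ⟨x, -, L, hL, h⟩
    exact ⟨L, x, hL, mem_reverse_paths_of_mem h⟩
  · refine nonempty_inter_plus hB fun n ↦ ?_
    obtain ⟨z, x, hx, L, hL, h⟩ := closure_nonempty_iff.1 ⟨y, key n⟩
    exact ⟨x, hx, L, z, hL, h⟩

lemma isClosed_reach_of_minus_subset {B : Set X} (hB : IsClosed B) (h : D.minus ⊆ B) :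
    IsClosed (D.reach B) := by
  refine isClosed_of_closure_subset fun y hy ↦ ?_
  by_contra hy'
  have hm := (of_mem_closure_reach hB hy hy').1
  exact hy' ⟨y, h hm, 0, flow_subset_paths (D.flow_refl (minus_subset_dom hm))⟩

lemma isClosed_reach_of_disjoint_plus {B : Set X} (hB : IsClosed B) (h : Disjoint B D.plus) :
    IsClosed (D.reach B) := by
  refine isClosed_of_closure_subset fun y hy ↦ ?_
  by_contra hy'
  exact (of_mem_closure_reach hB hy hy').2.ne_empty h.inter_eq

/-- Beyond the definition of `plus`, the end-point is again in `plus`; limits of such end-points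
then lie in both `plus` and `minus`. -/
lemma exists_long_path_of_mem_plus {x : X} (hx : x ∈ D.plus) (n : ℕ) :
    ∃ L, ∃ y ∈ D.plus, (n : ℝ) ≤ L ∧ (x, L, y) ∈ D.paths := by
  induction n with
  | zero => exact ⟨0, x, hx, by simp, flow_subset_paths (D.flow_refl (plus_subset_dom hx))⟩
  | succ n ih =>
    obtain ⟨L, y, hy, hL, h⟩ := ih
    obtain ⟨t, u, z, h₁, h₂, hz⟩ := exists_step_of_mem_plus hy
    refine ⟨L + t + 1, z, hz, ?_, ?_⟩
    · push_cast
      linarith [D.flow_nonneg h₁]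
    · rcases h₂ with h₂ | h₂
      · exact paths_add_jump (paths_add_flow h h₁) h₂
      · exact paths_add_flow (paths_add_flow h h₁) h₂

/-- Followed backward within `minus`, a point off `P` never meets `W`, by invariance. The points so
found start arbitrarily long paths, so by compactness some point of `minus ∩ plus` lies off `W`. -/
lemma Invariant.minus_subset {P W : Set X} (hP : D.Invariant P) (hW : IsOpen W)
    (h : D.minus ∩ D.plus ⊆ W) (hWP : W ⊆ P) : D.minus ⊆ P := by
  intro x hx
  by_contra hxP
  obtain ⟨y, ⟨h₁, h₂⟩, h₃⟩ := nonempty_inter_plus (D := D) (isClosed_minus.sdiff hW) fun n ↦ by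
    obtain ⟨L, y, hy, hL, hp⟩ := exists_long_path_of_mem_plus (D := D.reverse) hx n
    have hp := mem_reverse_paths.1 hp
    exact ⟨y, ⟨hy, fun hyW ↦ hxP (hP y (hWP hyW) L x hp)⟩, L, x, hL, hp⟩
  exact h₂ (h ⟨h₁, h₃⟩)

/-- The forward counterpart: long paths within `plus` starting in `P` end in `P`, and their ends
accumulate in `P ∩ minus ∩ plus`. -/
lemma Invariant.disjoint_plus {P : Set X} (hP : D.Invariant P) (hPc : IsClosed P)
    (h : Disjoint P (D.minus ∩ D.plus)) : Disjoint P D.plus := by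
  rw [disjoint_left]
  intro x hx hxp
  obtain ⟨y, ⟨h₁, h₂⟩, h₃⟩ := nonempty_inter_plus (D := D.reverse) (hPc.inter isClosed_plus)
    fun n ↦ by
      obtain ⟨L, y, hy, hL, hp⟩ := exists_long_path_of_mem_plus hxp n
      exact ⟨y, ⟨hP x hx L y hp, hy⟩, L, x, hL, mem_reverse_paths_of_mem hp⟩
  exact disjoint_left.1 h h₁ ⟨h₃, h₂⟩

end Compact

/-! ### Infinite chains from arbitrarily long paths. -/

section Chain

variable {X : Type*} [TopologicalSpace X] [CompactSpace X] {D : FlowJump X}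

lemma exists_chain_of_mem_plus {x : X} (hx : x ∈ D.plus) :
    ∃ c : ℕ → X × (ℝ × ℤ), c 0 = (x, (0, 0)) ∧ (∀ n, D.Elementary (c n) (c (n + 1))) ∧
      ∀ n : ℕ, (n : ℝ) ≤ (c (2 * n)).2.1 + ((c (2 * n)).2.2 : ℝ) := by
  have step : ∀ a : {a : X × (ℝ × ℤ) // a.1 ∈ D.plus}, ∃ (m : X × (ℝ × ℤ))
      (b : {b : X × (ℝ × ℤ) // b.1 ∈ D.plus}), D.Elementary a m ∧ D.Elementary m b ∧
      a.1.2.1 + (a.1.2.2 : ℝ) + 1 ≤ b.1.2.1 + (b.1.2.2 : ℝ) := by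
    rintro ⟨⟨y, t, n⟩, hy⟩
    obtain ⟨s, u, z, h₁, h₂, hz⟩ := exists_step_of_mem_plus hy
    have hs := D.flow_nonneg h₁
    rcases h₂ with h₂ | h₂
    · refine ⟨(u, (t + s, n)), ⟨(z, (t + s, n + 1)), hz⟩, Or.inl ⟨rfl, by simpa using h₁⟩,
        Or.inr ⟨rfl, rfl, h₂⟩, ?_⟩
      push_cast
      linarith
    · refine ⟨(u, (t + s, n)), ⟨(z, (t + s + 1, n)), hz⟩, Or.inl ⟨rfl, by simpa using h₁⟩,
        Or.inl ⟨rfl, by simpa using h₂⟩, ?_⟩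
      simp only
      linarith
  choose m b h₁ h₂ h₃ using step
  let s : ℕ → {a : X × (ℝ × ℤ) // a.1 ∈ D.plus} := fun n ↦ b^[n] ⟨(x, (0, 0)), hx⟩
  have hs : ∀ n, s (n + 1) = b (s n) := fun n ↦ Function.iterate_succ_apply' b n _
  -- Each move is a flow followed by a flow or jump: even indices carry the iterated states, odd
  -- ones the intermediate points.
  refine ⟨fun n ↦ if Even n then s (n / 2) else m (s (n / 2)), by simp [s], fun n ↦ ?_, fun n ↦ ?_⟩
  · rcases Nat.even_or_odd' n with ⟨k, rfl | rfl⟩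
    · simp only [even_two_mul, if_true, Nat.not_even_two_mul_add_one, if_false,
        Nat.mul_div_cancel_left k two_pos, show (2 * k + 1) / 2 = k by omega]
      exact h₁ _
    · simp only [Nat.not_even_two_mul_add_one, if_false, show (2 * k + 1) / 2 = k by omega,
        show 2 * k + 1 + 1 = 2 * (k + 1) by ring, even_two_mul, if_true,
        Nat.mul_div_cancel_left (k + 1) two_pos, hs]
      exact h₂ _
  · simp only [even_two_mul, if_true, Nat.mul_div_cancel_left n two_pos]
    induction n with
    | zero => simp [s]
    | succ n ih =>
      rw [hs]
      push_cast
      linarith [h₃ (s n)]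

end Chain

/-! ### Construction of the index pair. -/

section Metric

variable {X : Type*} [MetricSpace X] [CompactSpace X] {D : FlowJump X}

/-- `P` is the reach of a small closed thickening of `minus` in `dom`. The reaches shrink to
`minus`: a point off `minus` is the end only of paths of bounded length, so if all the reaches
contained it, a limit of starting points in `minus` would lead to it, and `minus` is invariant. -/
lemma exists_invariant_nhd_minus {U : Set X} (hU : IsOpen U) (h : D.minus ⊆ U) :
    ∃ P W, IsClosed P ∧ D.Invariant P ∧ P ⊆ U ∧ P ⊆ D.dom ∧ IsOpen W ∧ D.minus ⊆ W ∧
      W ∩ D.dom ⊆ P := by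
  let B : ℕ → Set X := fun n ↦ Metric.cthickening (1 / (n + 1 : ℝ)) D.minus ∩ D.dom
  have hBc : ∀ n, IsClosed (B n) := fun n ↦ Metric.isClosed_cthickening.inter D.isClosed_dom
  have hBanti : Antitone B := fun m n hmn ↦ inter_subset_inter_left _
    (Metric.cthickening_mono (Nat.one_div_le_one_div hmn) _)
  have hBm : ∀ n, D.minus ⊆ B n := fun n ↦
    subset_inter (Metric.self_subset_cthickening _) minus_subset_dom
  have hBi : ⋂ n, B n ⊆ D.minus := by
    intro x hx
    rw [mem_iInter] at hx
    have h0 : Metric.infEDist x D.minus ≤ 0 := by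
      refine ge_of_tendsto' (x := Filter.atTop)
        (f := fun n : ℕ ↦ ENNReal.ofReal (1 / (n + 1 : ℝ))) ?_ fun n ↦ (hx n).1
      simpa using ENNReal.tendsto_ofReal tendsto_one_div_add_atTop_nhds_zero_nat
    rw [← isClosed_minus.closure_eq, Metric.mem_closure_iff_infEDist_zero]
    exact le_antisymm h0 bot_le
  have hR : ∀ n, IsClosed (D.reach (B n)) := fun n ↦
    isClosed_reach_of_minus_subset (hBc n) (hBm n)
  obtain ⟨n, hn⟩ : ∃ n, D.reach (B n) ⊆ U := by
    refine exists_subset_nhds_of_isCompact' (V := fun n ↦ D.reach (B n)) (fun i j ↦ ⟨max i j,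
      reach_mono (hBanti (Nat.le_max_left i j)), reach_mono (hBanti (Nat.le_max_right i j))⟩)
      (fun n ↦ (hR n).isCompact) hR fun y hy ↦ hU.mem_nhds (h ?_)
    by_contra hym
    obtain ⟨M, hM⟩ : ∃ M : ℝ, ∀ L x, M ≤ L → (x, L, y) ∉ D.paths := by
      rw [mem_minus_iff] at hym
      push Not at hym
      exact hym
    have hS : ∀ n, IsClosed (B n ∩ {x | ∃ y' ∈ ({y} : Set X), ∃ L ∈ Icc 0 M,
        (y', L, x) ∈ D.reverse.paths}) := fun n ↦
      (hBc n).inter (isClosed_reach_Icc isClosed_singleton 0 M)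
    obtain ⟨x, hx⟩ := IsCompact.nonempty_iInter_of_sequence_nonempty_isCompact_isClosed _
      (fun n ↦ inter_subset_inter_left _ (hBanti n.le_succ)) (fun n ↦ by
        obtain ⟨x, hx, L, hL⟩ := mem_iInter.1 hy n
        refine ⟨x, hx, y, rfl, L, ⟨paths_nonneg hL, ?_⟩, mem_reverse_paths_of_mem hL⟩
        by_contra! hlt
        exact hM L x hlt.le hL) (hS 0).isCompact hS
    rw [mem_iInter] at hx
    obtain ⟨-, y', rfl, L, -, hL⟩ := hx 0
    exact hym (mem_minus_of_paths (mem_reverse_paths.1 hL)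
      (hBi (mem_iInter.2 fun n ↦ (hx n).1)))
  refine ⟨D.reach (B n), Metric.thickening (1 / (n + 1 : ℝ)) D.minus, hR n, invariant_reach _, hn,
    ?_, Metric.isOpen_thickening, Metric.self_subset_thickening Nat.one_div_pos_of_nat _, ?_⟩
  · rintro y ⟨x, -, L, hL⟩
    exact (paths_mem hL).2
  · exact (inter_subset_inter_left _ (Metric.thickening_subset_cthickening _ _)).trans
      (subset_reach inter_subset_right)

theorem exists_index_pair {U V : Set X} (hU : IsOpen U) (hV : IsOpen V) (hmU : D.minus ⊆ U)
    (hpV : D.minus ∩ D.plus ⊆ V) :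
    ∃ P₁ P₂ W, IsClosed P₁ ∧ IsClosed P₂ ∧ P₂ ⊆ P₁ ∧ P₁ ⊆ D.dom ∧ D.Invariant P₁ ∧
      D.Invariant P₂ ∧ P₁ ⊆ U ∧ IsOpen W ∧ D.minus ⊆ W ∧ W ∩ D.dom ⊆ P₁ ∧ Disjoint P₂ D.plus ∧
      closure (P₁ \ P₂) ⊆ V := by
  have hdisj : Disjoint (D.minus \ V) D.plus :=
    disjoint_left.2 fun x hx hx' ↦ hx.2 (hpV ⟨hx.1, hx'⟩)
  -- `Q` surrounds the part of `minus` outside `V`, and `O` surrounds `plus`. With `P ⊆ Q ∪ V` and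
  -- `P \ P₂ ⊆ O`, the closure of `P \ P₂` misses the open set `Q` and so lies in `V`.
  obtain ⟨Q, O, hQ, hO, hmQ, hpO, hQO⟩ :=
    normal_separation (isClosed_minus.sdiff hV) isClosed_plus hdisj
  obtain ⟨P, W, hPc, hPi, hPU, hPd, hW, hmW, hWP⟩ := exists_invariant_nhd_minus
    (D := D) (hU.inter (hQ.union hV)) (fun x hx ↦ ⟨hmU hx, by
      by_cases hxV : x ∈ V
      · exact Or.inr hxV
      · exact Or.inl (hmQ ⟨hx, hxV⟩)⟩)
  have hB : IsClosed (P \ O) := hPc.sdiff hO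
  have hBp : Disjoint (P \ O) D.plus := disjoint_left.2 fun x hx hx' ↦ hx.2 (hpO hx')
  refine ⟨P, D.reach (P \ O), W, hPc, isClosed_reach_of_disjoint_plus hB hBp,
    hPi.reach_subset sdiff_subset, hPd, hPi, invariant_reach _,
    hPU.trans inter_subset_left, hW, hmW, hWP, ?_, ?_⟩
  · rw [disjoint_left]
    rintro y ⟨x, hx, L, hL⟩ hy
    exact disjoint_left.1 hBp hx (mem_plus_of_paths hL hy)
  · intro x hx
    have hsub : P \ D.reach (P \ O) ⊆ P ∩ O := fun y hy ↦ ⟨hy.1, by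
      by_contra hyO
      exact hy.2 (subset_reach (sdiff_subset.trans hPd) ⟨hy.1, hyO⟩)⟩
    have h₁ : x ∈ P := closure_minimal (fun y hy ↦ hy.1) hPc hx
    have h₂ : x ∈ closure O := closure_mono (hsub.trans inter_subset_right) hx
    exact (hPU h₁).2.resolve_left fun hxQ ↦
      disjoint_left.1 (hQO.closure_right hQ) hxQ h₂

end Metric

end FlowJump

/-! ### The restricted semiflow: splitting, concatenation, closedness. -/

namespace SemiflowRel

variable {X : Type*} [TopologicalSpace X] {Φ : SemiflowRel X} {C : Set X}

/-- Every segment of a solution path in `C` belongs to `Φ_C`. -/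
lemma mem_restrict_of_path {a b s t : ℝ} {ξ : ℝ → X} (hξ : Φ.IsSolutionPathOn (Icc a b) ξ)
    (hC : ∀ r ∈ Icc a b, ξ r ∈ C) (has : a ≤ s) (hst : s ≤ t) (htb : t ≤ b) :
    (ξ s, t - s, ξ t) ∈ Φ.restrict C := by
  have hmem : ∀ r ∈ Icc 0 (t - s), s + r ∈ Icc a b := fun r hr ↦
    ⟨by linarith [hr.1], by linarith [hr.2]⟩
  refine ⟨sub_nonneg.2 hst, fun r ↦ ξ (s + r), fun t₁ h₁ t₂ h₂ hlt ↦ ?_,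
    fun r hr ↦ hC _ (hmem r hr), by simp, by simp⟩
  have := hξ _ (hmem t₁ h₁) _ (hmem t₂ h₂) (by linarith)
  simpa using this

lemma restrict_mono {C' : Set X} (h : C ⊆ C') : Φ.restrict C ⊆ Φ.restrict C' := by
  rintro q ⟨ht, ξ, hξ, hC, h'⟩
  exact ⟨ht, ξ, hξ, fun s hs ↦ h (hC s hs), h'⟩

lemma restrict_subset : Φ.restrict C ⊆ Φ.carrier := by
  rintro ⟨x, t, y⟩ ⟨ht, ξ, hξ, -, h₀, h₁⟩
  simp only at ht hξ h₀ h₁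
  rcases ht.eq_or_lt with rfl | ht
  · exact (Φ.initial _ _).2 (h₁.symm.trans h₀)
  · have := hξ 0 ⟨le_rfl, ht.le⟩ t ⟨ht.le, le_rfl⟩ ht
    rwa [h₀, h₁, sub_zero] at this

lemma mem_of_mem_restrict {x y : X} {t : ℝ} (h : (x, t, y) ∈ Φ.restrict C) : x ∈ C ∧ y ∈ C := by
  obtain ⟨ht, ξ, -, hC, h₀, h₁⟩ := h
  simp only at ht hC h₀ h₁
  exact ⟨h₀ ▸ hC 0 ⟨le_rfl, ht⟩, h₁ ▸ hC _ ⟨ht, le_rfl⟩⟩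

lemma restrict_split {x y : X} {s t : ℝ} (hs : 0 ≤ s) (ht : 0 ≤ t)
    (h : (x, s + t, y) ∈ Φ.restrict C) :
    ∃ z, (x, s, z) ∈ Φ.restrict C ∧ (z, t, y) ∈ Φ.restrict C := by
  obtain ⟨-, ξ, hξ, hC, h₀, h₁⟩ := h
  simp only at hξ hC h₀ h₁
  refine ⟨ξ s, ?_, ?_⟩
  · simpa [h₀] using mem_restrict_of_path hξ hC le_rfl hs (by linarith)
  · simpa [h₁] using mem_restrict_of_path hξ hC hs (by linarith : s ≤ s + t) le_rfl

lemma restrict_add {x y z : X} {s t : ℝ} (h : (x, s, y) ∈ Φ.restrict C)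
    (h' : (y, t, z) ∈ Φ.restrict C) : (x, s + t, z) ∈ Φ.restrict C := by
  obtain ⟨hs, ξ, hξ, hC, h₀, h₁⟩ := h
  obtain ⟨ht, η, hη, hC', h₀', h₁'⟩ := h'
  simp only at hs hξ hC h₀ h₁ ht hη hC' h₀' h₁'
  have hη₀ : ∀ r ∈ Icc 0 t, (y, r, η r) ∈ Φ.carrier := fun r hr ↦ by
    simpa [h₀'] using restrict_subset (mem_restrict_of_path hη hC' le_rfl hr.1 hr.2)
  have hξ₁ : ∀ r ∈ Icc 0 s, (ξ r, s - r, y) ∈ Φ.carrier := fun r hr ↦ by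
    simpa [h₁] using restrict_subset (mem_restrict_of_path hξ hC hr.1 hr.2 le_rfl)
  refine ⟨add_nonneg hs ht, fun r ↦ if r ≤ s then ξ r else η (r - s), ?_, ?_, ?_, ?_⟩
  · intro t₁ m₁ t₂ m₂ hlt
    simp only at m₁ m₂
    by_cases c₁ : t₁ ≤ s <;> by_cases c₂ : t₂ ≤ s
    · simp only [c₁, c₂, if_true]
      exact hξ _ ⟨m₁.1, c₁⟩ _ ⟨m₂.1, c₂⟩ hlt
    · simp only [c₁, c₂, if_true, if_false]
      have := (Φ.kolmogorov (ξ t₁) (η (t₂ - s)) (s - t₁) (t₂ - s) (by linarith) (by linarith)).2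
        ⟨y, hξ₁ _ ⟨m₁.1, c₁⟩, hη₀ _ ⟨by linarith, by linarith [m₂.2]⟩⟩
      convert this using 3
      ring
    · exact absurd (hlt.le.trans c₂) c₁
    · simp only [c₁, c₂, if_false]
      have := hη (t₁ - s) ⟨by linarith, by linarith [m₁.2]⟩ (t₂ - s)
        ⟨by linarith, by linarith [m₂.2]⟩ (by linarith)
      convert this using 3
      ring
  · intro r hr
    simp only at hr
    by_cases c : r ≤ s
    · simp only [c, if_true]
      exact hC r ⟨hr.1, c⟩
    · simp only [c, if_false]
      exact hC' _ ⟨by linarith, by linarith [hr.2]⟩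
  · simp [hs, h₀]
  · simp only
    split_ifs with c
    · obtain rfl : t = 0 := by linarith
      rw [add_zero, h₁, ← h₁', h₀']
    · rw [add_sub_cancel_left, h₁']

/-- Pointwise ultrafilter limits of the witnessing paths suffice: closedness of `Φ` and `C` passes
to the limit at each pair of times, and no continuity of paths is involved. -/
lemma isClosed_restrict [CompactSpace X] [T2Space X] (hC : IsClosed C) : IsClosed (Φ.restrict C) := by
  rw [isClosed_iff_ultrafilter]
  rintro ⟨x, t, y⟩ F hF hmem
  have hx : Filter.Tendsto (fun q : X × ℝ × X ↦ q.1) F (nhds x) :=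
    (continuous_fst.tendsto _).mono_left hF
  have ht : Filter.Tendsto (fun q : X × ℝ × X ↦ q.2.1) F (nhds t) :=
    ((by fun_prop : Continuous fun q : X × ℝ × X ↦ q.2.1).tendsto (x, t, y)).mono_left hF
  have hy : Filter.Tendsto (fun q : X × ℝ × X ↦ q.2.2) F (nhds y) :=
    ((by fun_prop : Continuous fun q : X × ℝ × X ↦ q.2.2).tendsto (x, t, y)).mono_left hF
  have ht0 : 0 ≤ t := ge_of_tendsto ht (Filter.mem_of_superset hmem fun q hq ↦ hq.1)
  have : ∀ q : X × ℝ × X, ∃ ξ : ℝ → X, q ∈ Φ.restrict C → Φ.IsSolutionPathOn (Icc 0 q.2.1) ξ ∧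
      (∀ s ∈ Icc 0 q.2.1, ξ s ∈ C) ∧ ξ 0 = q.1 ∧ ξ q.2.1 = q.2.2 := by
    intro q
    by_cases hq : q ∈ Φ.restrict C
    · obtain ⟨-, ξ, h⟩ := hq
      exact ⟨ξ, fun _ ↦ h⟩
    · exact ⟨fun _ ↦ x, fun h ↦ absurd h hq⟩
  choose ξ hξ using this
  -- The domains `[0, q.2.1]` vary with `q`, so times are truncated at `q.2.1`.
  have hlim : ∀ s : ℝ, ∃ z, Filter.Tendsto (fun q : X × ℝ × X ↦ ξ q (min s q.2.1)) F (nhds z) := by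
    intro s
    obtain ⟨z, -, hz⟩ := isCompact_iff_ultrafilter_le_nhds.1 (isCompact_univ (X := X))
      (F.map fun q : X × ℝ × X ↦ ξ q (min s q.2.1)) (by simp)
    exact ⟨z, hz⟩
  choose η hη using hlim
  have hmin : ∀ s : ℝ, Filter.Tendsto (fun q : X × ℝ × X ↦ min s q.2.1) F (nhds (min s t)) :=
    fun s ↦ tendsto_const_nhds.min ht
  refine ⟨ht0, η, fun t₁ h₁ t₂ h₂ hlt ↦ ?_, fun s hs ↦ ?_, ?_, ?_⟩
  · have hlim := (hη t₁).prodMk_nhds (((hmin t₂).sub (hmin t₁)).prodMk_nhds (hη t₂))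
    rw [min_eq_left h₁.2, min_eq_left h₂.2] at hlim
    refine Φ.isClosed.mem_of_tendsto hlim (Filter.mem_of_superset hmem fun q hq ↦ ?_)
    obtain ⟨hp, hpC, -, -⟩ := hξ q hq
    exact restrict_subset (mem_restrict_of_path hp hpC (le_min h₁.1 hq.1)
      (min_le_min_right _ hlt.le) (min_le_right _ _))
  · refine hC.mem_of_tendsto (hη s) (Filter.mem_of_superset hmem fun q hq ↦ ?_)
    exact (hξ q hq).2.1 _ ⟨le_min hs.1 hq.1, min_le_right _ _⟩
  · simp only
    refine tendsto_nhds_unique (hη 0) (hx.congr' (Filter.mem_of_superset hmem fun q hq ↦ ?_))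
    have h0 : min 0 q.2.1 = 0 := min_eq_left hq.1
    simp only [mem_ofPred_eq, h0]
    exact (hξ q hq).2.2.1.symm
  -- From the truncated time to the actual end the remaining duration tends to 0, so the initial
  -- condition identifies the two limits.
  · have hlim := (hη t).prodMk_nhds ((ht.sub (hmin t)).prodMk_nhds hy)
    rw [min_self, sub_self] at hlim
    refine ((Φ.initial _ _).1 (Φ.isClosed.mem_of_tendsto hlim
      (Filter.mem_of_superset hmem fun q hq ↦ ?_))).symm
    obtain ⟨hp, hpC, -, hp₁⟩ := hξ q hq
    have := restrict_subset (mem_restrict_of_path hp hpC (le_min ht0 hq.1)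
      (min_le_right t q.2.1) le_rfl)
    rwa [hp₁] at this

end SemiflowRel

/-! ### Order structure of hybrid time intervals. -/

section HybridTime

lemma HybridStep.le {p q : ℝ × ℤ} (h : HybridStep p q) : p ≤ q := by
  rcases h with ⟨h₁, h₂⟩ | ⟨h₁, h₂⟩
  · exact ⟨h₁, h₂.le⟩
  · exact ⟨h₁.le, h₂.le⟩

variable {p : ℤ → ℝ × ℤ}

lemma monotone_of_hybridStep (hp : ∀ i, HybridStep (p i) (p (i + 1))) : Monotone p :=
  monotone_int_of_le_succ fun i ↦ (hp i).le

/-- A transitive relation holds between any two comparable points of a hybrid time interval as soon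
as it holds within each of the intervals of which it is made up. -/
lemma hybridTime_induction (hp : ∀ i, HybridStep (p i) (p (i + 1))) {R : ℝ × ℤ → ℝ × ℤ → Prop}
    (local_rel : ∀ i, ∀ a ∈ Icc (p i) (p (i + 1)), ∀ b ∈ Icc (p i) (p (i + 1)), a ≤ b → R a b)
    (trans : ∀ a b c, a ≤ b → b ≤ c → R a b → R b c → R a c)
    {a b : ℝ × ℤ} (ha : a ∈ ⋃ i, Icc (p i) (p (i + 1))) (hb : b ∈ ⋃ i, Icc (p i) (p (i + 1)))
    (hab : a ≤ b) : R a b := by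
  have hm := monotone_of_hybridStep hp
  obtain ⟨i, hi⟩ := mem_iUnion.1 ha
  obtain ⟨j, hj⟩ := mem_iUnion.1 hb
  rcases le_or_gt i j with hij | hij
  · induction j, hij using Int.leInduction generalizing b with
    | base => exact local_rel i a hi b hj hab
    | succ j hij ih =>
      have h₁ : a ≤ p (j + 1) := hi.2.trans (hm (by omega))
      refine trans a (p (j + 1)) b h₁ hj.1
        (ih (mem_iUnion.2 ⟨j, (hp j).le, le_rfl⟩) h₁ ⟨(hp j).le, le_rfl⟩) ?_
      exact local_rel (j + 1) _ ⟨le_rfl, (hp (j + 1)).le⟩ b hj hj.1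
  · have : b ≤ a := hj.2.trans ((hm (by omega : j + 1 ≤ i)).trans hi.1)
    obtain rfl := le_antisymm hab this
    exact local_rel i a hi a hi le_rfl

lemma IsHybridTimeInterval.total {E : Set (ℝ × ℤ)} (hE : IsHybridTimeInterval E) {a b : ℝ × ℤ}
    (ha : a ∈ E) (hb : b ∈ E) : a ≤ b ∨ b ≤ a := by
  obtain ⟨p, hp, rfl⟩ := hE
  have hm := monotone_of_hybridStep hp
  obtain ⟨i, hi⟩ := mem_iUnion.1 ha
  obtain ⟨j, hj⟩ := mem_iUnion.1 hb
  rcases lt_trichotomy i j with h | rfl | h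
  · exact Or.inl (hi.2.trans ((hm (by omega : i + 1 ≤ j)).trans hj.1))
  · rcases hp i with ⟨-, h⟩ | ⟨h, -⟩
    · have h₁ : ∀ r ∈ Icc (p i) (p (i + 1)), r.2 = (p i).2 :=
        fun r hr ↦ le_antisymm (h ▸ hr.2.2) hr.1.2
      have h₂ : a.2 = b.2 := (h₁ a hi).trans (h₁ b hj).symm
      exact (le_total a.1 b.1).imp (fun h ↦ ⟨h, h₂.le⟩) fun h ↦ ⟨h, h₂.ge⟩
    · have h₁ : ∀ r ∈ Icc (p i) (p (i + 1)), r.1 = (p i).1 :=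
        fun r hr ↦ le_antisymm (h ▸ hr.2.1) hr.1.1
      have h₂ : a.1 = b.1 := (h₁ a hi).trans (h₁ b hj).symm
      exact (le_total a.2 b.2).imp (fun h ↦ ⟨h₂.le, h⟩) fun h ↦ ⟨h₂.ge, h⟩
  · exact Or.inr (hj.2.trans ((hm (by omega : j + 1 ≤ i)).trans hi.1))

end HybridTime

/-! ### Translation between hybrid solution paths and finite paths or chains. -/

namespace HybridSystem

section

variable {X : Type*} [TopologicalSpace X] {H : HybridSystem X} {K : Set X} {hK : IsClosed K}
  {E : Set (ℝ × ℤ)} {ξ : ℝ × ℤ → X}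

lemma isSolutionPath_restrict_iff (hξ : ∀ r ∈ E, ξ r ∈ K) :
    (H.restrict K hK).IsSolutionPath E ξ ↔ H.IsSolutionPath E ξ := by
  constructor
  · rintro ⟨hE, h₁, h₂⟩
    exact ⟨hE, fun t₁ t₂ n m₁ m₂ hlt ↦
      SemiflowRel.restrict_mono inter_subset_left (h₁ t₁ t₂ n m₁ m₂ hlt),
      fun t n m₁ m₂ ↦ (h₂ t n m₁ m₂).1⟩
  · rintro ⟨hE, h₁, h₂⟩
    refine ⟨hE, fun t₁ t₂ n m₁ m₂ hlt ↦ ?_, fun t n m₁ m₂ ↦ ⟨h₂ t n m₁ m₂, hξ _ m₁, hξ _ m₂⟩⟩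
    -- The path witnessing membership in `Φ_C` might leave `K`. Since rows of `E` are convex, `ξ`
    -- itself, which stays in `K`, can serve as witness.
    have hrow : ∀ t ∈ Icc t₁ t₂, (t, n) ∈ E := by
      obtain ⟨p, hp, rfl⟩ := hE
      have := hybridTime_induction hp (R := fun a b ↦ a.2 = b.2 → ∀ t ∈ Icc a.1 b.1,
          (t, b.2) ∈ ⋃ i, Icc (p i) (p (i + 1)))
        (fun i a ha b hb _ hab t ht ↦ mem_iUnion.2 ⟨i, ⟨ha.1.1.trans ht.1, hb.1.2⟩,
          ⟨ht.2.trans hb.2.1, hb.2.2⟩⟩)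
        (fun a b c hab hbc h₁ h₂ hac t ht ↦ by
          have hb : b.2 = c.2 := le_antisymm hbc.2 (hac ▸ hab.2)
          rcases le_total t b.1 with h | h
          · rw [← hb]
            exact h₁ (hac.trans hb.symm) t ⟨ht.1, h⟩
          · exact h₂ hb t ⟨h, ht.2⟩)
        m₁ m₂ ⟨hlt.le, le_rfl⟩ rfl
      exact this
    refine SemiflowRel.mem_restrict_of_path (ξ := fun r ↦ ξ (r, n)) (a := t₁) (b := t₂)
      (fun s₁ hs₁ s₂ hs₂ hlt ↦
        SemiflowRel.restrict_subset (h₁ s₁ s₂ n (hrow _ hs₁) (hrow _ hs₂) hlt))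
      (fun r hr ↦ ⟨?_, hξ _ (hrow r hr)⟩) le_rfl hlt.le le_rfl
    rcases hr.1.eq_or_lt with rfl | hr'
    · exact (SemiflowRel.mem_of_mem_restrict (h₁ _ _ n m₁ m₂ hlt)).1
    · exact (SemiflowRel.mem_of_mem_restrict (h₁ _ _ n m₁ (hrow r hr) hr')).2

end

variable {X : Type*} [TopologicalSpace X] [CompactSpace X] [T2Space X]

/-- The flow and jump relations of `H` within `K`. -/
def toFlowJump (H : HybridSystem X) (K : Set X) (hK : IsClosed K) : FlowJump X where
  dom := K
  -- Trivial flows are added on all of `K`, because jumps may begin and end outside `C`.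
  flow := H.Φ.restrict (H.C ∩ K) ∪ {q | q.1 ∈ K ∧ q.2.1 = 0 ∧ q.2.2 = q.1}
  jump := H.G ∩ K ×ˢ K
  isClosed_dom := hK
  isClosed_flow := (SemiflowRel.isClosed_restrict (H.isClosed_C.inter hK)).union
    ((hK.preimage continuous_fst).inter
      ((isClosed_eq (by fun_prop) continuous_const).inter (isClosed_eq (by fun_prop) (by fun_prop))))
  isClosed_jump := H.isClosed_G.inter (hK.prod hK)
  flow_nonneg := by
    rintro x t y (h | ⟨-, h, -⟩)
    · exact h.1
    · exact h.ge
  flow_mem := by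
    rintro x t y (h | ⟨h₁, -, h₂⟩)
    · exact (SemiflowRel.mem_of_mem_restrict h).imp And.right And.right
    · simp only at h₁ h₂
      exact ⟨h₁, h₂ ▸ h₁⟩
  flow_refl h := Or.inr ⟨h, rfl, rfl⟩
  flow_zero := by
    rintro x y (h | ⟨-, -, h⟩)
    · exact ((H.Φ.initial x y).1 (SemiflowRel.restrict_subset h)).symm
    · exact h.symm
  flow_add := by
    rintro x y z s t (h | ⟨h₁, h₂, h₃⟩) (h' | ⟨h₁', h₂', h₃'⟩)
    · exact Or.inl (SemiflowRel.restrict_add h h')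
    · simp only at h₂' h₃'
      subst h₂' h₃'
      simpa using Or.inl h
    · simp only at h₂ h₃
      subst h₂ h₃
      simpa using Or.inl h'
    · simp only at h₂ h₃ h₂' h₃'
      subst h₂ h₃ h₂' h₃'
      exact Or.inr ⟨h₁, add_zero 0, rfl⟩
  flow_split := by
    rintro x y s t hs ht (h | ⟨h₁, h₂, h₃⟩)
    · obtain ⟨z, h₁, h₂⟩ := SemiflowRel.restrict_split hs ht h
      exact ⟨z, Or.inl h₁, Or.inl h₂⟩
    · simp only at h₁ h₂ h₃
      obtain rfl : s = 0 := by linarith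
      obtain rfl : t = 0 := by linarith
      exact ⟨x, Or.inr ⟨h₁, rfl, rfl⟩, Or.inr ⟨h₁, rfl, h₃⟩⟩
  jump_mem h := h.2

variable {H : HybridSystem X} {K : Set X} {hK : IsClosed K}

lemma mem_restrict_of_mem_flow {x y : X} {t : ℝ} (h : (x, t, y) ∈ (H.toFlowJump K hK).flow)
    (ht : 0 < t) : (x, t, y) ∈ H.Φ.restrict (H.C ∩ K) :=
  h.resolve_right fun h ↦ ht.ne' h.2.1

/-- The condition `ξ a ∈ K` is needed for `a = b`, since a one-point interval puts no constraint on
`ξ`. -/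
lemma mem_paths_of_isSolutionPath {E : Set (ℝ × ℤ)} {ξ : ℝ × ℤ → X}
    (h : (H.restrict K hK).IsSolutionPath E ξ) {a b : ℝ × ℤ} (ha : a ∈ E) (hb : b ∈ E)
    (hab : a ≤ b) (haK : ξ a ∈ K) :
    (ξ a, b.1 + b.2 - (a.1 + a.2), ξ b) ∈ (H.toFlowJump K hK).paths := by
  obtain ⟨⟨p, hp, rfl⟩, h₁, h₂⟩ := h
  refine hybridTime_induction hp (R := fun a b ↦ ξ a ∈ K →
    (ξ a, b.1 + b.2 - (a.1 + a.2), ξ b) ∈ (H.toFlowJump K hK).paths) ?_ ?_ ha hb hab haK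
  · rintro i ⟨t, m⟩ hm ⟨t', n⟩ hn ⟨htt', hmn⟩ hK'
    simp only at htt' hmn
    have hmi : (t, m) ∈ ⋃ i, Icc (p i) (p (i + 1)) := mem_iUnion.2 ⟨i, hm⟩
    have hni : (t', n) ∈ ⋃ i, Icc (p i) (p (i + 1)) := mem_iUnion.2 ⟨i, hn⟩
    rcases hp i with ⟨-, h⟩ | ⟨h, -⟩
    · obtain rfl : m = n := le_antisymm hmn (hn.2.2.trans (h ▸ hm.1.2))
      rcases htt'.eq_or_lt with rfl | hlt
      · simpa using FlowJump.flow_subset_paths ((H.toFlowJump K hK).flow_refl hK')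
      · simpa using FlowJump.flow_subset_paths
          (D := H.toFlowJump K hK) (Or.inl (h₁ t t' m hmi hni hlt))
    · obtain rfl : t = t' := le_antisymm htt' (hn.2.1.trans (h ▸ hm.1.1))
      clear hni
      induction n, hmn using Int.leInduction with
      | base => simpa using FlowJump.flow_subset_paths ((H.toFlowJump K hK).flow_refl hK')
      | succ n hmn ih =>
        have hn' : (t, n) ∈ Icc (p i) (p (i + 1)) :=
          ⟨hm.1.trans ⟨le_rfl, hmn⟩, ⟨hn.2.1, (by simp : n ≤ n + 1).trans hn.2.2⟩⟩
        have hj := h₂ t n (mem_iUnion.2 ⟨i, hn'⟩) (mem_iUnion.2 ⟨i, hn⟩)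
        convert FlowJump.paths_add_jump (ih hn') hj using 3
        simp
        ring
  · intro a b c _ _ hab hbc ha
    have h' := hab ha
    convert FlowJump.paths_add h' (hbc (FlowJump.paths_mem h').2) using 3
    ring

lemma exists_segment {a b : X × (ℝ × ℤ)} (h : (H.toFlowJump K hK).Elementary a b) :
    ∃ γ : ℝ × ℤ → X, γ a.2 = a.1 ∧ γ b.2 = b.1 ∧
      ∀ r ∈ Icc a.2 b.2, ∀ s ∈ Icc a.2 b.2, r ≤ s →
        (r.2 = s.2 → (γ r, s.1 - r.1, γ s) ∈ (H.toFlowJump K hK).flow) ∧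
        (r.1 = s.1 → s.2 = r.2 + 1 → (γ r, γ s) ∈ (H.toFlowJump K hK).jump) := by
  obtain ⟨x, t, m⟩ := a
  obtain ⟨y, t', n⟩ := b
  rcases h with ⟨h₁, h₂⟩ | ⟨h₁, h₂, h₃⟩
  · simp only at h₁ h₂
    subst h₁
    have key : ∃ ξ : ℝ → X, ξ 0 = x ∧ ξ (t' - t) = y ∧ ∀ r s, 0 ≤ r → r ≤ s → s ≤ t' - t →
        (ξ r, s - r, ξ s) ∈ (H.toFlowJump K hK).flow := by
      rcases h₂ with ⟨-, ξ, hξ, hC, h₀, h₁⟩ | ⟨hx, ht, hy⟩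
      · exact ⟨ξ, h₀, h₁, fun r s hr hrs hs ↦
          Or.inl (SemiflowRel.mem_restrict_of_path hξ hC hr hrs hs)⟩
      · simp only at hx ht hy
        refine ⟨fun _ ↦ x, rfl, hy.symm, fun r s hr hrs hs ↦ ?_⟩
        obtain rfl : r = s := by linarith
        simpa using (H.toFlowJump K hK).flow_refl hx
    obtain ⟨ξ, h₀, h₁, hξ⟩ := key
    refine ⟨fun r ↦ ξ (r.1 - t), by simpa using h₀, h₁, fun r hr s hs hrs ↦ ⟨fun _ ↦ ?_, ?_⟩⟩
    · have := hξ (r.1 - t) (s.1 - t) (sub_nonneg.2 hr.1.1) (sub_le_sub_right hrs.1 t)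
        (sub_le_sub_right hs.2.1 t)
      simpa using this
    · intro _ h
      have h₁ : s.2 ≤ m := hs.2.2
      have h₂ : m ≤ r.2 := hr.1.2
      omega
  · simp only at h₁ h₂ h₃
    subst h₁ h₂
    refine ⟨fun r ↦ if r.2 = m then x else y, by simp, by simp,
      fun r hr s hs hrs ↦ ⟨fun h ↦ ?_, fun _ h ↦ ?_⟩⟩
    · have : s.1 - r.1 = 0 := sub_eq_zero.2 (le_antisymm (hs.2.1.trans hr.1.1) hrs.1)
      simp only [h, this]
      refine (H.toFlowJump K hK).flow_refl ?_
      split_ifs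
      exacts [h₃.2.1, h₃.2.2]
    · have h₁ : s.2 ≤ m + 1 := hs.2.2
      have h₂ : m ≤ r.2 := hr.1.2
      obtain rfl : r.2 = m := by omega
      simpa [h] using h₃

/-- A bi-infinite chain of flows and jumps is realized by a solution path. -/
theorem exists_isSolutionPath_of_chain {c : ℤ → X × (ℝ × ℤ)}
    (hc : ∀ i, (H.toFlowJump K hK).Elementary (c i) (c (i + 1))) :
    ∃ ξ : ℝ × ℤ → X, (H.restrict K hK).IsSolutionPath (⋃ i, Icc (c i).2 (c (i + 1)).2) ξ ∧
      (∀ i, ξ (c i).2 = (c i).1) ∧ ∀ r ∈ ⋃ i, Icc (c i).2 (c (i + 1)).2, ξ r ∈ K := by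
  have hp : ∀ i, HybridStep (c i).2 (c (i + 1)).2 := fun i ↦ (hc i).hybridStep
  have hm : Monotone fun i ↦ (c i).2 := monotone_of_hybridStep hp
  choose γ hγ₀ hγ₁ hγ using fun i ↦ exists_segment (hc i)
  -- Trivial steps repeat labels. Equal labels carry equal states, so overlapping segments agree and
  -- can be glued.
  have hconst : ∀ i j, i ≤ j → (c i).2 = (c j).2 → (c i).1 = (c j).1 := by
    intro i j hij
    induction j, hij using Int.leInduction with
    | base => exact fun _ ↦ rfl
    | succ j hij ih =>
      intro h
      have h' : (c j).2 = (c (j + 1)).2 := le_antisymm (hm (by omega)) (h ▸ hm hij)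
      exact (ih (h.trans h'.symm)).trans ((hc j).eq_of_eq h')
  have hagree : ∀ i j, i < j → ∀ r, r ∈ Icc (c i).2 (c (i + 1)).2 → r ∈ Icc (c j).2 (c (j + 1)).2 →
      γ i r = γ j r := by
    intro i j hij r hi hj
    have hij' : (c (i + 1)).2 ≤ (c j).2 := hm hij
    have h₁ : r = (c (i + 1)).2 := le_antisymm hi.2 (hij'.trans hj.1)
    have h₂ : r = (c j).2 := le_antisymm (hi.2.trans hij') hj.1
    rw [h₁, hγ₁, ← h₁, h₂, hγ₀]
    exact hconst _ _ hij (h₁ ▸ h₂)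
  have hsel : ∀ r, ∃ i, r ∈ ⋃ i, Icc (c i).2 (c (i + 1)).2 → r ∈ Icc (c i).2 (c (i + 1)).2 := by
    intro r
    by_cases hr : r ∈ ⋃ i, Icc (c i).2 (c (i + 1)).2
    · exact (mem_iUnion.1 hr).imp fun i h _ ↦ h
    · exact ⟨0, fun h ↦ absurd h hr⟩
  choose k hk using hsel
  have hξ : ∀ i r, r ∈ Icc (c i).2 (c (i + 1)).2 → γ (k r) r = γ i r := by
    intro i r hr
    have hkr := hk r (mem_iUnion.2 ⟨i, hr⟩)
    rcases lt_trichotomy (k r) i with h | h | h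
    · exact hagree _ _ h r hkr hr
    · rw [h]
    · exact (hagree _ _ h r hr hkr).symm
  have hflow : ∀ a ∈ ⋃ i, Icc (c i).2 (c (i + 1)).2, ∀ b ∈ ⋃ i, Icc (c i).2 (c (i + 1)).2, a ≤ b →
      a.2 = b.2 → (γ (k a) a, b.1 - a.1, γ (k b) b) ∈ (H.toFlowJump K hK).flow := by
    intro a ha b hb hab
    refine hybridTime_induction hp (R := fun a b ↦ a.2 = b.2 →
      (γ (k a) a, b.1 - a.1, γ (k b) b) ∈ (H.toFlowJump K hK).flow) ?_ ?_ ha hb hab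
    · intro i a ha b hb hab h
      rw [hξ i a ha, hξ i b hb]
      exact (hγ i a ha b hb hab).1 h
    · intro a b d hab hbd h₁ h₂ had
      have hb : b.2 = d.2 := le_antisymm hbd.2 (had ▸ hab.2)
      convert (H.toFlowJump K hK).flow_add (h₁ (had.trans hb.symm)) (h₂ hb) using 3
      ring
  have hjump : ∀ a ∈ ⋃ i, Icc (c i).2 (c (i + 1)).2, ∀ b ∈ ⋃ i, Icc (c i).2 (c (i + 1)).2, a ≤ b →
      a.1 = b.1 → b.2 = a.2 + 1 → (γ (k a) a, γ (k b) b) ∈ (H.toFlowJump K hK).jump := by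
    intro a ha b hb hab
    refine hybridTime_induction hp (R := fun a b ↦ a.1 = b.1 → b.2 = a.2 + 1 →
      (γ (k a) a, γ (k b) b) ∈ (H.toFlowJump K hK).jump) ?_ ?_ ha hb hab
    · intro i a ha b hb hab h
      rw [hξ i a ha, hξ i b hb]
      exact (hγ i a ha b hb hab).2 h
    · intro a b d hab hbd h₁ h₂ had hda
      have hb₁ : b.1 = d.1 := le_antisymm hbd.1 (had ▸ hab.1)
      have h₃ : a.2 ≤ b.2 := hab.2
      have h₄ : b.2 ≤ d.2 := hbd.2
      rcases h₃.eq_or_lt with h | h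
      · obtain rfl : a = b := Prod.ext (had.trans hb₁.symm) h
        exact h₂ had hda
      · obtain rfl : b = d := Prod.ext hb₁ (by omega)
        exact h₁ had hda
  refine ⟨fun r ↦ γ (k r) r, ⟨⟨_, hp, rfl⟩, fun t₁ t₂ n h₁ h₂ hlt ↦ ?_, fun t n h₁ h₂ ↦ ?_⟩,
    fun i ↦ ?_, fun r hr ↦ ?_⟩
  · exact mem_restrict_of_mem_flow (hflow _ h₁ _ h₂ ⟨hlt.le, le_rfl⟩ rfl) (sub_pos.2 hlt)
  · exact hjump _ h₁ _ h₂ ⟨le_rfl, by simp⟩ rfl rfl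
  · exact (hξ i _ ⟨le_rfl, (hp i).le⟩).trans (hγ₀ i)
  · exact ((H.toFlowJump K hK).flow_mem (hflow r hr r hr le_rfl rfl)).1

/-- A forward and a backward chain from the same state are realized by a solution path. -/
lemma exists_isSolutionPath_of_chains {f g : ℕ → X × (ℝ × ℤ)} (h₀ : f 0 = g 0)
    (hf : ∀ n, (H.toFlowJump K hK).Elementary (f n) (f (n + 1)))
    (hg : ∀ n, (H.toFlowJump K hK).Elementary (g (n + 1)) (g n)) :
    ∃ (E : Set (ℝ × ℤ)) (ξ : ℝ × ℤ → X), (H.restrict K hK).IsSolutionPath E ξ ∧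
      (∀ r ∈ E, ξ r ∈ K) ∧ (∀ n, (f n).2 ∈ E ∧ ξ (f n).2 = (f n).1) ∧ (∀ n, (g n).2 ∈ E) ∧
      ∀ r ∈ E, ∃ n, (g n).2 ≤ r ∧ r ≤ (f n).2 := by
  obtain ⟨c, hc, hcf, hcg⟩ := FlowJump.exists_int_chain h₀ hf hg
  obtain ⟨ξ, h₁, h₂, h₃⟩ := exists_isSolutionPath_of_chain hc
  have hp : ∀ i, HybridStep (c i).2 (c (i + 1)).2 := fun i ↦ (hc i).hybridStep
  have hm : Monotone fun i ↦ (c i).2 := monotone_of_hybridStep hp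
  have hmem : ∀ i, (c i).2 ∈ ⋃ i, Icc (c i).2 (c (i + 1)).2 :=
    fun i ↦ mem_iUnion.2 ⟨i, le_rfl, (hp i).le⟩
  refine ⟨_, ξ, h₁, h₃, fun n ↦ ?_, fun n ↦ ?_, fun r hr ↦ ?_⟩
  · rw [← hcf]
    exact ⟨hmem _, h₂ _⟩
  · rw [← hcg]
    exact hmem _
  · obtain ⟨i, hi⟩ := mem_iUnion.1 hr
    refine ⟨i.natAbs + 1, ?_, ?_⟩
    · rw [← hcg]
      exact (hm (by omega)).trans hi.1
    · rw [← hcf]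
      exact hi.2.trans (hm (by omega))

/-- Compactness enters through `exists_chain_of_mem_plus`, which turns arbitrarily long finite paths
into one infinite chain. The constant backward chain makes `(0, 0)` the left end-point. -/
lemma plusPart_eq (hK : IsClosed K) : H.plusPart K = (H.toFlowJump K hK).plus := by
  ext x
  constructor
  · rintro ⟨E, ξ, h, hE, hinf, hξ, rfl⟩
    rw [FlowJump.mem_plus_iff]
    intro M
    obtain ⟨p, hp, hM⟩ := hinf M
    exact ⟨_, ξ p, by simpa using hM, mem_paths_of_isSolutionPath
      ((isSolutionPath_restrict_iff (hK := hK) hξ).2 h) hE.1 hp (hE.2 hp) (hξ _ hE.1)⟩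
  · intro hx
    obtain ⟨f, hf₀, hf, hlen⟩ := FlowJump.exists_chain_of_mem_plus hx
    obtain ⟨E, ξ, h₁, h₂, h₃, -, h₅⟩ := exists_isSolutionPath_of_chains (f := f)
      (g := fun _ ↦ (x, (0, 0))) hf₀ hf fun _ ↦ .refl (FlowJump.plus_subset_dom hx)
    have h0 := h₃ 0
    rw [hf₀] at h0
    refine ⟨E, ξ, (isSolutionPath_restrict_iff h₂).1 h₁, ⟨h0.1, fun r hr ↦ ?_⟩, fun M ↦ ?_,
      h₂, h0.2⟩
    · obtain ⟨n, hn, -⟩ := h₅ r hr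
      exact hn
    · obtain ⟨n, hn⟩ := exists_nat_ge M
      exact ⟨_, (h₃ (2 * n)).1, hn.trans (hlen n)⟩

/-- A backward chain of infinite length. -/
lemma exists_backward_chain {x : X} (hx : x ∈ (H.toFlowJump K hK).minus) :
    ∃ g : ℕ → X × (ℝ × ℤ), g 0 = (x, (0, 0)) ∧
      (∀ n, (H.toFlowJump K hK).Elementary (g (n + 1)) (g n)) ∧
      ∀ M : ℝ, ∃ n, (g n).2.1 + ((g n).2.2 : ℝ) ≤ M := by
  obtain ⟨f, hf₀, hf, hlen⟩ := FlowJump.exists_chain_of_mem_plus hx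
  refine ⟨fun n ↦ ((f n).1, -(f n).2), by simp [hf₀], fun n ↦ (hf n).of_reverse, fun M ↦ ?_⟩
  obtain ⟨n, hn⟩ := exists_nat_ge (-M)
  refine ⟨2 * n, ?_⟩
  have := hlen n
  simp
  linarith

lemma minusPart_eq (hK : IsClosed K) : H.minusPart K = (H.toFlowJump K hK).minus := by
  ext x
  constructor
  · rintro ⟨E, ξ, h, hE, hinf, hξ, rfl⟩
    rw [FlowJump.mem_minus_iff]
    intro M
    obtain ⟨p, hp, hM⟩ := hinf (-M)
    refine ⟨_, ξ p, ?_, mem_paths_of_isSolutionPath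
      ((isSolutionPath_restrict_iff (hK := hK) hξ).2 h) hp hE.1 (hE.2 hp) (hξ _ hp)⟩
    simp only [Int.cast_zero]
    linarith
  · intro hx
    obtain ⟨g, hg₀, hg, hlen⟩ := exists_backward_chain hx
    obtain ⟨E, ξ, h₁, h₂, h₃, h₄, h₅⟩ := exists_isSolutionPath_of_chains
      (f := fun _ ↦ (x, (0, 0))) hg₀.symm (fun _ ↦ .refl (FlowJump.minus_subset_dom hx)) hg
    refine ⟨E, ξ, (isSolutionPath_restrict_iff h₂).1 h₁, ⟨(h₃ 0).1, fun r hr ↦ ?_⟩, fun M ↦ ?_,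
      h₂, (h₃ 0).2⟩
    · obtain ⟨n, -, hn⟩ := h₅ r hr
      exact hn
    · obtain ⟨n, hn⟩ := hlen M
      exact ⟨_, h₄ n, hn⟩

lemma viablePart_eq (hK : IsClosed K) :
    H.viablePart K = (H.toFlowJump K hK).minus ∩ (H.toFlowJump K hK).plus := by
  ext x
  constructor
  · rintro ⟨E, ξ, h, hback, hforw, hξ, r, hr, rfl⟩
    have h' := (isSolutionPath_restrict_iff (hK := hK) hξ).2 h
    have htot : ∀ a ∈ E, ∀ b ∈ E, a.1 + (a.2 : ℝ) < b.1 + (b.2 : ℝ) → a ≤ b := by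
      intro a ha b hb hlt
      rcases h.1.total ha hb with hab | hba
      · exact hab
      · have h₁ : b.1 ≤ a.1 := hba.1
        have h₂ : (b.2 : ℝ) ≤ a.2 := by exact_mod_cast hba.2
        linarith
    rw [mem_inter_iff, FlowJump.mem_minus_iff, FlowJump.mem_plus_iff]
    constructor
    · intro M
      -- The maximum with 1 makes the comparison of `t + n` strict, so that `htot` applies.
      obtain ⟨p, hp, hM⟩ := hback (r.1 + r.2 - max M 1)
      have h₁ := le_max_left M 1
      have h₂ := le_max_right M 1
      exact ⟨_, ξ p, by linarith, mem_paths_of_isSolutionPath h' hp hr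
        (htot p hp r hr (by linarith)) (hξ _ hp)⟩
    · intro M
      obtain ⟨p, hp, hM⟩ := hforw (r.1 + r.2 + max M 1)
      have h₁ := le_max_left M 1
      have h₂ := le_max_right M 1
      exact ⟨_, ξ p, by linarith, mem_paths_of_isSolutionPath h' hr hp
        (htot r hr p hp (by linarith)) (hξ _ hr)⟩
  · rintro ⟨hm, hp⟩
    obtain ⟨g, hg₀, hg, hlen⟩ := exists_backward_chain hm
    obtain ⟨f, hf₀, hf, hlen'⟩ := FlowJump.exists_chain_of_mem_plus hp
    obtain ⟨E, ξ, h₁, h₂, h₃, h₄, -⟩ := exists_isSolutionPath_of_chains (hf₀.trans hg₀.symm) hf hg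
    have h0 := h₃ 0
    rw [hf₀] at h0
    refine ⟨E, ξ, (isSolutionPath_restrict_iff h₂).1 h₁, fun M ↦ ?_, fun M ↦ ?_, h₂, _, h0⟩
    · obtain ⟨n, hn⟩ := hlen M
      exact ⟨_, h₄ n, hn⟩
    · obtain ⟨n, hn⟩ := exists_nat_ge M
      exact ⟨_, (h₃ (2 * n)).1, hn.trans (hlen' n)⟩

/-- Invariance need only be tested on single flows and jumps, and each of these is realized on a
compact hybrid interval by a chain constant before and after it. -/
lemma plusInvariant_restrict_iff {P : Set X} (hP : P ⊆ K) :
    (H.restrict K hK).PlusInvariant P ↔ (H.toFlowJump K hK).Invariant P := by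
  constructor
  · intro h
    have key : ∀ a b : X × (ℝ × ℤ), (H.toFlowJump K hK).Elementary a b → a.1 ∈ P → b.1 ∈ P := by
      intro a b hab ha
      have hb : b.1 ∈ K := by
        rcases hab with ⟨-, h⟩ | ⟨-, -, h⟩
        · exact ((H.toFlowJump K hK).flow_mem h).2
        · exact h.2.2
      obtain ⟨E, ξ, h₁, -, h₃, h₄, h₅⟩ := exists_isSolutionPath_of_chains
        (f := fun n ↦ if n = 0 then a else b) (g := fun _ ↦ a) (by simp)
        (fun n ↦ by
          rcases n with _ | n
          · simpa using hab
          · simpa using FlowJump.Elementary.refl hb)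
        (fun _ ↦ .refl (hP ha))
      have hle := hab.hybridStep.le
      have ha' : a.2 ∈ E ∧ ξ a.2 = a.1 := by simpa using h₃ 0
      have hb' : b.2 ∈ E ∧ ξ b.2 = b.1 := by simpa using h₃ 1
      have := h E ξ a.2 b.2 h₁ ⟨ha'.1, fun r hr ↦ (h₅ r hr).choose_spec.1⟩
        ⟨hb'.1, fun r hr ↦ by
          obtain ⟨n, -, hn⟩ := h₅ r hr
          refine hn.trans ?_
          split_ifs
          exacts [hle, le_rfl]⟩ (by rwa [ha'.2]) b.2 hb'.1
      rwa [hb'.2] at this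
    refine FlowJump.invariant_of_flow_of_jump (fun x hx t y hf ↦ ?_) (fun x hx y hj ↦ ?_)
    · exact key (x, (0, 0)) (y, (t, 0)) (Or.inl ⟨rfl, by simpa using hf⟩) hx
    · exact key (x, (0, 0)) (y, (0, 1)) (Or.inr ⟨rfl, rfl, hj⟩) hx
  · intro h E ξ p q hξ hp _ hpP r hr
    exact h _ hpP _ _ (mem_paths_of_isSolutionPath hξ hp.1 hr (hp.2 hr) (hP hpP))

end HybridSystem

/-! ### Boundaries of invariant sets. -/

namespace SemiflowRel

variable {X : Type*} [TopologicalSpace X]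

lemma timeRel_mono (Φ : SemiflowRel X) (C : Set X) {a b b' : ℝ} (h : b ≤ b') :
    Φ.timeRel C a b ⊆ Φ.timeRel C a b' :=
  fun _ ⟨t, ht, hq⟩ ↦ ⟨t, ⟨ht.1, ht.2.trans h⟩, hq⟩

lemma isClosed_carrier_Icc [CompactSpace X] [T2Space X] {Φ : SemiflowRel X} {P : Set X}
    (hP : IsClosed P) (ε : ℝ) :
    IsClosed {y | ∃ x ∈ P, ∃ t ∈ Icc 0 ε, (x, t, y) ∈ Φ.carrier} := by
  have hc : IsCompact {q : X × ℝ × X | q ∈ Φ.carrier ∧ q.1 ∈ P ∧ q.2.1 ∈ Icc 0 ε} := by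
    refine ((isCompact_univ (X := X)).prod ((isCompact_Icc (a := (0 : ℝ)) (b := ε)).prod
      (isCompact_univ (X := X)))).of_isClosed_subset ?_ fun q hq ↦
        ⟨mem_univ _, hq.2.2, mem_univ _⟩
    exact Φ.isClosed.inter ((hP.preimage continuous_fst).inter
      (isClosed_Icc.preimage (by fun_prop)))
  convert (hc.image (f := fun q : X × ℝ × X ↦ q.2.2) (by fun_prop)).isClosed using 1
  ext y
  constructor
  · rintro ⟨x, hx, t, ht, h⟩
    exact ⟨(x, t, y), ⟨h, hx, ht⟩, rfl⟩
  · rintro ⟨⟨x, t, y⟩, ⟨h, hx, ht⟩, rfl⟩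
    exact ⟨x, hx, t, ht, h⟩

end SemiflowRel

lemma relObstruction_mono {X : Type*} [TopologicalSpace X] {F F' : SetRel X X} (h : F ⊆ F')
    (P : Set X) : relObstruction F P ⊆ relObstruction F' P :=
  closure_mono (sdiff_subset_sdiff_left fun _ ⟨x, hx, hxy⟩ ↦ ⟨x, hx, h hxy⟩)

namespace HybridSystem

variable {X : Type*} [MetricSpace X] [CompactSpace X] {H : HybridSystem X} {K : Set X}
  {hK : IsClosed K}

lemma relObstruction_jump_subset {P : Set X} (hPK : P ⊆ K)
    (hP : (H.toFlowJump K hK).Invariant P) : relObstruction H.G P ⊆ closure Kᶜ := by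
  refine closure_mono ?_
  rintro y ⟨⟨x, hx, hxy⟩, hyP⟩ hyK
  exact hyP (hP x hx 1 y (FlowJump.jump_mem_paths ⟨hxy, hPK hx, hyK⟩))

/-- A short flow path leaving the invariant set `P` passes through a point outside `K`. -/
lemma exists_notMem_of_timeRel {P : Set X} (hP : (H.toFlowJump K hK).Invariant P)
    {ε : ℝ} {x y : X} (hx : x ∈ P) (hy : y ∉ P) (h : (x, y) ∈ H.Φ.timeRel H.C 0 ε) :
    (∃ t ∈ Icc 0 ε, (x, t, y) ∈ H.Φ.carrier) ∧
      ∃ z ∉ K, ∃ t ∈ Icc 0 ε, (z, t, y) ∈ H.Φ.carrier := by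
  obtain ⟨t, ht, h | ⟨-, h⟩⟩ := h
  · refine ⟨⟨t, ht, SemiflowRel.restrict_subset h⟩, ?_⟩
    obtain ⟨ht0, ξ, hξ, hC, h₀, h₁⟩ := h
    simp only at ht0 hξ hC h₀ h₁
    by_contra! hcon
    have hin : ∀ s ∈ Icc 0 t, ξ s ∈ K := by
      intro s hs
      by_contra hsK
      refine hcon _ hsK (t - s) ⟨by linarith [hs.2], by linarith [hs.1, ht.2]⟩ ?_
      rw [← h₁]
      exact SemiflowRel.restrict_subset (SemiflowRel.mem_restrict_of_path hξ hC hs.1 hs.2 le_rfl)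
    exact hy (hP x hx t y (FlowJump.flow_subset_paths
      (Or.inl ⟨ht0, ξ, hξ, fun s hs ↦ ⟨hC s hs, hin s hs⟩, h₀, h₁⟩)))
  · simp only at h
    exact absurd (h ▸ hx) hy

/-- Points reached within arbitrarily short time from a closed set belong to it. -/
lemma mem_of_forall_short {P : Set X} (hP : IsClosed P) {y : X}
    (h : ∀ ε > 0, ∃ x ∈ P, ∃ t ∈ Icc 0 ε, (x, t, y) ∈ H.Φ.carrier) : y ∈ P := by
  choose x hx t ht hxy using fun n : ℕ ↦ h (1 / (n + 1 : ℝ)) Nat.one_div_pos_of_nat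
  obtain ⟨x₀, hx₀, φ, hφ, hlim⟩ := hP.isCompact.tendsto_subseq hx
  have htlim : Filter.Tendsto t Filter.atTop (nhds 0) :=
    squeeze_zero (fun n ↦ (ht n).1) (fun n ↦ (ht n).2) tendsto_one_div_add_atTop_nhds_zero_nat
  have hmem := H.Φ.isClosed.mem_of_tendsto
    (hlim.prodMk_nhds ((htlim.comp hφ.tendsto_atTop).prodMk_nhds
      (tendsto_const_nhds (x := y)))) (Filter.Eventually.of_forall fun n ↦ hxy (φ n))
  rwa [(H.Φ.initial _ _).1 hmem]

/-- For every `ε`, the point is reached within time `ε` both from `P` and from the closure of `Kᶜ`;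
as `ε` tends to 0 it lies in both. Membership in `P` is thus a consequence, although the
intersection does not impose it. -/
lemma iInter_relObstruction_timeRel_subset {P : Set X} (hPc : IsClosed P)
    (hP : (H.toFlowJump K hK).Invariant P) :
    ⋂ ε : {ε : ℝ // 0 < ε}, relObstruction (H.Φ.timeRel H.C 0 ε) P ⊆ P ∩ closure Kᶜ := by
  intro y hy
  rw [mem_iInter] at hy
  constructor
  · refine mem_of_forall_short (H := H) hPc fun ε hε ↦ ?_
    refine closure_minimal ?_ (SemiflowRel.isClosed_carrier_Icc hPc ε) (hy ⟨ε, hε⟩)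
    rintro z ⟨⟨x, hx, hxz⟩, hz⟩
    obtain ⟨t, ht, h⟩ := (exists_notMem_of_timeRel hP hx hz hxz).1
    exact ⟨x, hx, t, ht, h⟩
  · refine mem_of_forall_short (H := H) isClosed_closure fun ε hε ↦ ?_
    refine closure_minimal ?_ (SemiflowRel.isClosed_carrier_Icc isClosed_closure ε) (hy ⟨ε, hε⟩)
    rintro z ⟨⟨x, hx, hxz⟩, hz⟩
    obtain ⟨w, hw, t, ht, h⟩ := (exists_notMem_of_timeRel hP hx hz hxz).2
    exact ⟨w, subset_closure hw, t, ht, h⟩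

lemma boundary_subset {P : Set X} (hPc : IsClosed P) (hPK : P ⊆ K)
    (hP : (H.toFlowJump K hK).Invariant P) : H.boundary P ⊆ P ∩ frontier K := by
  have : P ∩ closure Kᶜ ⊆ P ∩ frontier K := fun y hy ↦ ⟨hy.1, by
    rw [frontier_eq_closure_inter_closure]
    exact ⟨subset_closure (hPK hy.1), hy.2⟩⟩
  refine (union_subset ?_ ?_).trans this
  · exact inter_subset_inter_right _ (relObstruction_jump_subset hPK hP)
  · exact iInter_relObstruction_timeRel_subset hPc hP

/-- If every `ε` failed, compactness of `closure (P \ Q)` would give a point there in all the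
obstruction sets, hence in the closure of `Kᶜ`, whereas `hQ` places it in `interior K`. -/
lemma exists_relBoundary_subset {P Q : Set X} (hPc : IsClosed P)
    (hP : (H.toFlowJump K hK).Invariant P) (hQ : closure (P \ Q) ⊆ interior K) :
    ∃ ε : ℝ, 0 < ε ∧ relBoundary (H.Φ.timeRel H.C 0 ε) P ⊆ Q := by
  by_contra! hcon
  let S : ℕ → Set X := fun n ↦
    closure (P \ Q) ∩ relObstruction (H.Φ.timeRel H.C 0 (1 / (n + 1 : ℝ))) P
  have hS : ∀ n, IsClosed (S n) := fun n ↦ isClosed_closure.inter isClosed_closure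
  obtain ⟨y, hy⟩ := IsCompact.nonempty_iInter_of_sequence_nonempty_isCompact_isClosed S
    (fun n ↦ inter_subset_inter_right _ (relObstruction_mono (H.Φ.timeRel_mono H.C
      (Nat.one_div_le_one_div n.le_succ)) P))
    (fun n ↦ by
      obtain ⟨y, ⟨h₁, h₂⟩, h₃⟩ := not_subset.1 (hcon (1 / (n + 1 : ℝ)) Nat.one_div_pos_of_nat)
      exact ⟨y, subset_closure ⟨h₁, h₃⟩, h₂⟩) (hS 0).isCompact hS
  rw [mem_iInter] at hy
  have hmem : y ∈ closure Kᶜ := by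
    refine (iInter_relObstruction_timeRel_subset hPc hP (mem_iInter.2 ?_)).2
    rintro ⟨ε, hε⟩
    obtain ⟨n, hn⟩ := exists_nat_one_div_lt hε
    exact relObstruction_mono (H.Φ.timeRel_mono H.C hn.le) P (hy n).2
  rw [closure_compl] at hmem
  exact hmem (hQ (hy 0).1)

end HybridSystem

theorem mainTheorem12 {X : Type*} [MetricSpace X] [CompactSpace X] (H : HybridSystem X)
    (K A : Set X) (hK : H.IsIsolatingNeighborhood K A) :
    (∀ P₁ P₂ : Set X, H.IsIndexPair K hK.isClosed A P₁ P₂ →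
      H.minusPart K ⊆ P₁ ∧
      H.plusPart K ∩ P₂ = ∅ ∧
      H.boundary P₁ ⊆ P₁ ∩ frontier K ∧
      P₁ ∩ frontier K ⊆ P₂ ∧
      (closure (P₁ \ P₂) ⊆ interior K →
        ∃ ε : ℝ, 0 < ε ∧ relBoundary (H.Φ.timeRel H.C 0 ε) P₁ ⊆ P₂)) ∧
    (∀ U V : Set X, IsOpen U → IsOpen V →
      H.minusPart K ⊆ U → H.viablePart K ⊆ V → V ⊆ K →
      ∃ P₁ P₂ : Set X, H.IsIndexPair K hK.isClosed A P₁ P₂ ∧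
        P₁ ⊆ U ∧ closure (P₁ \ P₂) ⊆ V ∧ closure (P₁ \ P₂) ⊆ interior K) := by
  have hv := HybridSystem.viablePart_eq (H := H) hK.isClosed
  rw [HybridSystem.minusPart_eq hK.isClosed, HybridSystem.plusPart_eq hK.isClosed]
  constructor
  · intro P₁ P₂ hP
    have h₁ := (HybridSystem.plusInvariant_restrict_iff hP.fst_subset).1 hP.plusInvariant_fst
    have h₂ := (HybridSystem.plusInvariant_restrict_iff
      (hP.snd_subset_fst.trans hP.fst_subset)).1 hP.plusInvariant_snd
    have hA : (H.toFlowJump K hK.isClosed).minus ∩ (H.toFlowJump K hK.isClosed).plus ⊆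
        interior P₁ \ P₂ := by
      rw [← hv, ← hK.eq_viablePart]
      exact hP.subset_interior_diff
    refine ⟨h₁.minus_subset isOpen_interior (hA.trans sdiff_subset) interior_subset,
      (h₂.disjoint_plus hP.isClosed_snd (disjoint_left.2 fun x hx hx' ↦
        (hA hx').2 hx)).symm.inter_eq,
      HybridSystem.boundary_subset hP.isClosed_fst hP.fst_subset h₁, fun x hx ↦ ?_,
      HybridSystem.exists_relBoundary_subset hP.isClosed_fst h₁⟩
    by_contra hx₂
    exact hx.2.2 (hP.diff_subset_interior ⟨hx.1, hx₂⟩)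
  · intro U V hU hV hmU hvV hVK
    rw [hv] at hvV
    obtain ⟨P₁, P₂, W, hc₁, hc₂, h₂₁, h₁K, hi₁, hi₂, h₁U, hW, hmW, hWP, hd, hcl⟩ :=
      FlowJump.exists_index_pair hU hV hmU hvV
    have hVi : V ⊆ interior K := interior_maximal hVK hV
    refine ⟨P₁, P₂, ⟨hc₁, hc₂, h₂₁, h₁K, (HybridSystem.plusInvariant_restrict_iff h₁K).2 hi₁,
      (HybridSystem.plusInvariant_restrict_iff (h₂₁.trans h₁K)).2 hi₂, hK.eq_viablePart,
      ?_, subset_closure.trans (hcl.trans hVi)⟩, h₁U, hcl, hcl.trans hVi⟩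
    rw [hK.eq_viablePart]
    intro x hx
    have hxi := hK.viablePart_subset hx
    rw [hv] at hx
    -- Only `W ∩ K ⊆ P₁` is known; since `K_±` lies in `interior K`, the open set `W ∩ interior K`
    -- shows that its points are interior to `P₁`.
    exact ⟨interior_maximal ((inter_subset_inter_right W interior_subset).trans hWP)
      (hW.inter isOpen_interior) ⟨hmW hx.1, hxi⟩, disjoint_right.1 hd hx.2⟩
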